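/- Use polar coordinates $(r,\theta)$ on $\mathbb{R}^2$ with $\boldsymbol{\nu}=\langle\cos\theta,\sin\theta\rangle$, $\boldsymbol{\tau}=\langle-\sin\theta,\cos\theta\rangle$, and let $\mathbb{T}=\mathbb{R}/2\pi\mathbb{Z}$. Let $0<\lambda<\frac12$ and let $\psi\in H^1(\mathbb{T})$ be real valued (identified with its continuous representative). Put $\Psi(r,\theta)=r^{\lambda}\psi(\theta)$ and $$\mathbf{u}=\nabla^{\perp}\Psi=r^{\lambda-1}\left[\lambda\,\psi(\theta)\,\boldsymbol{\tau}-\psi'(\theta)\,\boldsymbol{\nu}\right],$$ where $\psi'\in L^2(\mathbb{T})$ is the weak derivative. Suppose that $\mathbf{u}$ is a weak solution of the stationary Euler equations $\mathbf{u}\cdot\nabla\mathbf{u}+\nabla p=0$, $\nabla\cdot\mathbf{u}=0$ on $\mathbb{R}^2\setminus\{0\}$ for some pressure distribution $p\in\mathcal{D}'(\mathbb{R}^2\setminus\{0\})$, that is, $$\int \mathbf{u}\cdot\nabla\mathbf{v}\cdot\mathbf{u}\,dx+\langle p,\nabla\cdot\mathbf{v}\rangle=0\quad\text{for all }\mathbf{v}\in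 C_0^\infty(\mathbb{R}^2\setminus\{0\};\mathbb{R}^2),$$ $$\int\mathbf{u}\cdot\nabla\eta\,dx=0\quad\text{for all }\eta\in C_0^\infty(\mathbb{R}^2\setminus\{0\}).$$ Then the flow is trivial, that is, either a rotational flow ($\psi$ is constant) or a parallel shear flow (up to a rotation, $\Psi=|x|^{\lambda}(A\chi_{\{x>0\}}+B\chi_{\{x\le0\}})$ with $A,B\in\mathbb{R}$). More precisely: 1. either $\psi\equiv0$ or $\psi$ is elliptic, i.e. vanishes nowhere; 2. $\psi$ is not hyperbolic, i.e. it is not the case that $\psi$ vanishes at two or more points of $\mathbb{T}$ without the flow being a parallel shear flow; 3. $\psi$ is not parabolic, i.e. $\psi$ does not vanish at exactly one point of $\mathbb{T}$; 4. if $\psi$ is elliptic, then $\psi$ is constant. -/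

import Mathlib

open scoped Real Distributions ContDiff

noncomputable section

namespace HomEuler

/-! ### The plane and polar coordinates

The plane `ℝ²` is identified with `ℂ`, as a real inner product space with Lebesgue measure. A function
of the angle is a `2π`-periodic function `ℝ → ℝ`. -/

/-- The radial unit vector `ν = ⟨cos θ, sin θ⟩`. -/
def radialVec (θ : ℝ) : ℂ := ⟨Real.cos θ, Real.sin θ⟩

/-- The angular unit vector `τ = ⟨-sin θ, cos θ⟩`. -/
def angularVec (θ : ℝ) : ℂ := ⟨-Real.sin θ, Real.cos θ⟩

/-- The plane without the origin. -/
def puncturedPlane : TopologicalSpace.Opens ℂ := ⟨{0}ᶜ, isOpen_compl_singleton⟩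

/-! ### The stationary Euler equation in the weak sense -/

/-- The divergence of a compactly supported smooth vector field `v`,
`∇ · v = ∂₁ v₁ + ∂₂ v₂`, as a test function. -/
def divergence {Ω : TopologicalSpace.Opens ℂ} (v : 𝓓(Ω, ℂ)) : 𝓓(Ω, ℝ) :=
  TestFunction.postcompCLM (𝕜 := ℝ) Complex.reCLM (TestFunction.lineDerivCLM ℝ (1 : ℂ) v) +
    TestFunction.postcompCLM (𝕜 := ℝ) Complex.imCLM (TestFunction.lineDerivCLM ℝ Complex.I v)

/-- `divergence` is the usual pointwise divergence. -/
theorem divergence_apply {Ω : TopologicalSpace.Opens ℂ} (v : 𝓓(Ω, ℂ)) (z : ℂ) :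
    divergence v z = (fderiv ℝ v z 1).re + (fderiv ℝ v z Complex.I).im := by
  have h : DifferentiableAt ℝ v z := (v.contDiff.differentiable (by simp)).differentiableAt
  simp [divergence, h.lineDeriv_eq_fderiv]

/-- The pair of a velocity field `u` and a pressure distribution `p` solves the stationary Euler system
`u · ∇u + ∇p = 0`, `∇ · u = 0` in the open set `Ω` in the weak sense. -/
structure IsWeakStationaryEuler (Ω : TopologicalSpace.Opens ℂ) (u : ℂ → ℂ) (p : 𝓓'(Ω, ℝ)) :
    Prop where
  /-- `u` is measurable and locally square integrable in `Ω`. -/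
  aestronglyMeasurable : MeasureTheory.AEStronglyMeasurable u (MeasureTheory.volume.restrict Ω)
  locallyIntegrableOn_sq : MeasureTheory.LocallyIntegrableOn (fun z => ‖u z‖ ^ 2) Ω
  /-- `∇ · u = 0` : `∫ u · ∇η = 0` for all scalar test functions `η`. -/
  incompressible : ∀ η : 𝓓(Ω, ℝ), ∫ z, fderiv ℝ η z (u z) = 0
  /-- `u · ∇u + ∇p = 0` : `∫ u · ∇v · u + p(∇ · v) = 0` for all test fields `v`. -/
  momentum : ∀ v : 𝓓(Ω, ℂ), (∫ z, inner ℝ (fderiv ℝ v z (u z)) (u z)) + p (divergence v) = 0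

/-! ### Homogeneous flows -/

/-- `ψ ∈ H¹(𝕋)`, given by its continuous representative, with weak derivative `dψ ∈ L²(𝕋)`. -/
structure IsH1Circle (ψ dψ : ℝ → ℝ) : Prop where
  periodic : Function.Periodic ψ (2 * π)
  continuous : Continuous ψ
  deriv_periodic : Function.Periodic dψ (2 * π)
  deriv_memLp : MeasureTheory.MemLp dψ 2 (MeasureTheory.volume.restrict (Set.Ioc (-π) π))
  weak_deriv : ∀ φ : ℝ → ℝ, ContDiff ℝ ∞ φ → Function.Periodic φ (2 * π) →
    ∫ θ in (-π)..π, ψ θ * deriv φ θ = -∫ θ in (-π)..π, dψ θ * φ θ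

/-- The velocity `u = ∇^⊥ Ψ = r ^ (λ - 1) (λ ψ τ - ψ' ν)` of the homogeneous stream function
`Ψ = r ^ λ ψ(θ)`; here `dψ` stands for `ψ'`. -/
def homVelocity (lam : ℝ) (ψ dψ : ℝ → ℝ) (z : ℂ) : ℂ :=
  (‖z‖ ^ (lam - 1)) •
    ((lam * ψ z.arg) • angularVec z.arg - dψ z.arg • radialVec z.arg)

/-- Rotational flow: `ψ` is constant. -/
def IsRotational (ψ : ℝ → ℝ) : Prop := ∃ c : ℝ, ∀ θ, ψ θ = c

open Classical in
/-- Parallel shear flow: up to a rotation, `Ψ = |x| ^ λ (A χ_{x > 0} + B χ_{x ≤ 0})`. -/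
def IsParallelShear (lam : ℝ) (ψ : ℝ → ℝ) : Prop :=
  ∃ A B θ₀ : ℝ, ∀ θ,
    ψ θ = |Real.cos (θ - θ₀)| ^ lam * (if 0 < Real.cos (θ - θ₀) then A else B)

/-- Trivial flows. -/
def IsTrivial (lam : ℝ) (ψ : ℝ → ℝ) : Prop := IsRotational ψ ∨ IsParallelShear lam ψ

/-- Elliptic type: `ψ` does not vanish. -/
def IsElliptic (ψ : ℝ → ℝ) : Prop := ∀ θ, ψ θ ≠ 0

/-- Parabolic type: `ψ` vanishes at exactly one point of the circle. -/
def IsParabolic (ψ : ℝ → ℝ) : Prop := ∃! θ, θ ∈ Set.Ioc (-π) π ∧ ψ θ = 0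

/-- Hyperbolic type: `ψ` vanishes at two or more points of the circle and the flow is not a
parallel shear flow. -/
def IsHyperbolic (lam : ℝ) (ψ : ℝ → ℝ) : Prop :=
  (∃ θ₁ ∈ Set.Ioc (-π) π, ∃ θ₂ ∈ Set.Ioc (-π) π, θ₁ ≠ θ₂ ∧ ψ θ₁ = 0 ∧ ψ θ₂ = 0) ∧
    ¬ IsParallelShear lam ψ

end HomEuler

end

/-!
Testing the momentum equation against the solenoidal fields `∇^⊥ Re (c h(|z|²) zⁿ)` eliminates the
pressure. In polar coordinates the radial integrals reduce, by parts, to multiples of one positive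
moment of `h`, which leaves for each `n` one relation between Fourier coefficients of `ψ'² - λ² ψ²`
and `λ ψ ψ'`. Together these relations are the profile equation
`λ (ψ ψ')' = (2 λ - 1) ψ'² - λ² ψ² - k`.

Put `γ = 1 / λ > 2`. Testing the profile equation with `|ψ| ^ (γ - 2)`, regularized at the zeros of
`ψ`, gives `λ² ∫ |ψ| ^ γ ≤ -k ∫ |ψ| ^ (γ - 2)`, so `ψ = 0` if `0 ≤ k`. If `k < 0`, testing with
`|ψ| ^ (2 γ - 2)` and Wirtinger's inequality for `|ψ| ^ γ` bound `∫ |ψ| ^ (2 γ - 2)` by the mean of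
`|ψ| ^ γ` times `∫ |ψ| ^ (γ - 2)`. This reverses Chebyshev's integral inequality, so `|ψ| ^ γ`
is constant.
-/

noncomputable section

namespace HomEuler

open MeasureTheory intervalIntegral Filter
open scoped Topology ComplexConjugate

/-! ### Absolutely continuous functions and Fourier coefficients on an interval -/

section Interval

variable {a b : ℝ} {f g q G : ℝ → ℝ}

theorem absolutelyContinuousOnInterval_congr (hf : AbsolutelyContinuousOnInterval f a b)
    (h : Set.EqOn f g (Set.uIcc a b)) : AbsolutelyContinuousOnInterval g a b := by
  refine Tendsto.congr' ?_ hf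
  filter_upwards [mem_inf_of_right (mem_principal_self _)] with E hE
  exact Finset.sum_congr rfl fun i hi => by rw [h (hE.1 i hi).1, h (hE.1 i hi).2]

theorem absolutelyContinuousOnInterval_lipschitzOnWith_comp {F : ℝ → ℝ} {s : Set ℝ} {K : NNReal}
    (hF : LipschitzOnWith K F s) (hf : AbsolutelyContinuousOnInterval f a b)
    (hs : Set.MapsTo f (Set.uIcc a b) s) :
    AbsolutelyContinuousOnInterval (fun x => F (f x)) a b := by
  refine squeeze_zero' (.of_forall fun E => Finset.sum_nonneg fun _ _ => dist_nonneg) ?_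
    (by simpa using Tendsto.const_mul (K : ℝ) hf)
  filter_upwards [mem_inf_of_right (mem_principal_self _)] with E hE
  rw [Finset.mul_sum]
  exact Finset.sum_le_sum fun i hi =>
    hF.dist_le_mul _ (hs (hE.1 i hi).1) _ (hs (hE.1 i hi).2)

theorem absolutelyContinuousOnInterval_contDiff_comp {F : ℝ → ℝ} (hF : ContDiff ℝ 1 F)
    (hf : AbsolutelyContinuousOnInterval f a b) :
    AbsolutelyContinuousOnInterval (fun x => F (f x)) a b := by
  obtain ⟨D, hD⟩ := hf.exists_bound
  obtain ⟨K, hK⟩ := (hF.contDiffOn (s := Set.Icc (-D) D)).exists_lipschitzOnWith (by decide)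
    (convex_Icc _ _) isCompact_Icc
  exact absolutelyContinuousOnInterval_lipschitzOnWith_comp hK hf fun x hx => abs_le.mp (hD x hx)

theorem absolutelyContinuousOnInterval_const_add_integral
    (hG : IntervalIntegrable G volume a b) (C : ℝ) :
    AbsolutelyContinuousOnInterval (fun x => C + ∫ t in a..x, G t) a b :=
  (ContDiffOn.absolutelyContinuousOnInterval (f := fun _ => C) contDiffOn_const).fun_add
    (hG.absolutelyContinuousOnInterval_intervalIntegral Set.left_mem_uIcc)

theorem ae_hasDerivAt_const_add_integral (hab : a ≤ b) (hG : IntervalIntegrable G volume a b)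
    (C : ℝ) :
    ∀ᵐ x ∂volume.restrict (Set.Ioc a b), HasDerivAt (fun x => C + ∫ t in a..x, G t) (G x) x := by
  rw [ae_restrict_iff' measurableSet_Ioc]
  filter_upwards [hG.ae_hasDerivAt_integral] with x hx hxI
  exact (hx (Set.uIcc_of_le hab ▸ Set.Ioc_subset_Icc_self hxI) a Set.left_mem_uIcc).const_add C

theorem memLp_restrict_Ioc_of_continuousOn {E : Type*} [NormedAddCommGroup E] {p : ENNReal}
    {f : ℝ → E} (hf : ContinuousOn f (Set.Icc a b)) :
    MemLp f p (volume.restrict (Set.Ioc a b)) := by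
  obtain ⟨D, hD⟩ := isCompact_Icc.exists_bound_of_continuousOn hf
  refine .of_bound ((hf.mono Set.Ioc_subset_Icc_self).aestronglyMeasurable measurableSet_Ioc) D ?_
  filter_upwards [ae_restrict_mem measurableSet_Ioc] with x hx
  exact hD x (Set.Ioc_subset_Icc_self hx)

theorem intervalIntegrable_ofReal {μ : Measure ℝ}
    (hf : IntervalIntegrable f μ a b) : IntervalIntegrable (fun x => (f x : ℂ)) μ a b :=
  ⟨hf.1.ofReal, hf.2.ofReal⟩

theorem integral_smul_deriv_eq_deriv_smul {E : Type*} [NormedAddCommGroup E] [NormedSpace ℝ E]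
    [CompleteSpace E] {w : ℝ → E} (hq : AbsolutelyContinuousOnInterval q a b)
    (hw : ContDiff ℝ 1 w) :
    ∫ x in a..b, q x • deriv w x = q b • w b - q a • w a - ∫ x in a..b, deriv q x • w x := by
  refine (SeparatingDual.eq_iff_forall_dual_eq (R := ℝ)).mpr fun L => ?_
  have hLw : ∀ x, L (deriv w x) = deriv (fun y => L (w y)) x := fun x =>
    (L.hasFDerivAt.comp_hasDerivAt x (hw.differentiable one_ne_zero x).hasDerivAt).deriv.symm
  have hLac : AbsolutelyContinuousOnInterval (fun y => L (w y)) a b :=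
    (L.contDiff.comp hw).contDiffOn.absolutelyContinuousOnInterval
  have hint : IntervalIntegrable (fun x => q x • deriv w x) volume a b :=
    (hq.continuousOn.smul (hw.continuous_deriv le_rfl).continuousOn).intervalIntegrable
  have hint' : IntervalIntegrable (fun x => deriv q x • w x) volume a b :=
    hq.intervalIntegrable_deriv.smul_continuousOn hw.continuous.continuousOn
  rw [map_sub, map_sub, ← L.intervalIntegral_comp_comm hint,
    ← L.intervalIntegral_comp_comm hint']
  simp only [map_smul, smul_eq_mul, hLw]
  exact hq.integral_mul_deriv_eq_deriv_mul hLac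

theorem integral_mul_eq_neg_of_ae_hasDerivAt (hab : a ≤ b) {u u' v v' : ℝ → ℝ}
    (hu : AbsolutelyContinuousOnInterval u a b) (hv : AbsolutelyContinuousOnInterval v a b)
    (hu' : ∀ᵐ x ∂volume.restrict (Set.Ioc a b), HasDerivAt u (u' x) x)
    (hv' : ∀ᵐ x ∂volume.restrict (Set.Ioc a b), HasDerivAt v (v' x) x)
    (hper : u a * v a = u b * v b) :
    ∫ x in a..b, u x * v' x = -∫ x in a..b, u' x * v x := by
  have hparts := hu.integral_mul_deriv_eq_deriv_mul hv
  rw [hper, sub_self, zero_sub] at hparts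
  calc ∫ x in a..b, u x * v' x = ∫ x in a..b, u x * deriv v x :=
        integral_congr_ae_restrict <| by
          rw [Set.uIoc_of_le hab]
          filter_upwards [hv'] with x hx
          rw [hx.deriv]
    _ = -∫ x in a..b, deriv u x * v x := hparts
    _ = -∫ x in a..b, u' x * v x := congrArg Neg.neg <| integral_congr_ae_restrict <| by
          rw [Set.uIoc_of_le hab]
          filter_upwards [hu'] with x hx
          rw [hx.deriv]

theorem eqOn_zero_of_integral_nonpos (hab : a < b)
    (hf : ContinuousOn f (Set.Icc a b)) (hnonneg : ∀ x ∈ Set.Icc a b, 0 ≤ f x)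
    (hint : ∫ x in a..b, f x ≤ 0) : Set.EqOn f 0 (Set.Icc a b) := by
  intro x hx
  by_contra hne
  exact hint.not_gt <| intervalIntegral.integral_pos hab hf
    (fun y hy => hnonneg y (Set.Ioc_subset_Icc_self hy))
    ⟨x, hx, lt_of_le_of_ne (hnonneg x hx) (Ne.symm hne)⟩

theorem rpow_sub_rpow_mul_sub_pos {x y s : ℝ} (hx : 0 ≤ x) (hy : 0 ≤ y) (hs : 0 < s)
    (hne : x ≠ y) : 0 < (x ^ s - y ^ s) * (x - y) := by
  rcases hne.lt_or_gt with hlt | hlt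
  · exact mul_pos_of_neg_of_neg (sub_neg.mpr (Real.rpow_lt_rpow hx hlt hs)) (sub_neg.mpr hlt)
  · exact mul_pos (sub_pos.mpr (Real.rpow_lt_rpow hy hlt hs)) (sub_pos.mpr hlt)

/-- The equality case of Chebyshev's integral inequality for the similarly ordered functions
`f ^ s` and `f`. -/
theorem eq_mean_of_integral_rpow_add_one_le {s : ℝ} (hab : a < b) (hs : 0 < s)
    (hf : ContinuousOn f (Set.Icc a b)) (hnonneg : ∀ x ∈ Set.Icc a b, 0 ≤ f x)
    (hint : ∫ x in a..b, f x ^ (s + 1) ≤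
      ((b - a)⁻¹ * ∫ x in a..b, f x) * ∫ x in a..b, f x ^ s) :
    ∀ x ∈ Set.Icc a b, f x = (b - a)⁻¹ * ∫ x in a..b, f x := by
  have hlen : 0 < b - a := sub_pos.mpr hab
  have hicc : Set.uIcc a b = Set.Icc a b := Set.uIcc_of_le hab.le
  set m := (b - a)⁻¹ * ∫ x in a..b, f x with hm
  have hm0 : 0 ≤ m := mul_nonneg (inv_nonneg.mpr hlen.le) (integral_nonneg hab.le hnonneg)
  have hfs : ∀ {t : ℝ}, 0 < t → ContinuousOn (fun x => f x ^ t) (Set.Icc a b) :=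
    fun ht => hf.rpow_const fun _ _ => Or.inr ht.le
  have hii : ∀ {g : ℝ → ℝ}, ContinuousOn g (Set.Icc a b) → IntervalIntegrable g volume a b :=
    fun hg => (hicc ▸ hg).intervalIntegrable
  have hexpand : ∫ x in a..b, (f x ^ s - m ^ s) * (f x - m) =
      (∫ x in a..b, f x ^ (s + 1)) - m * ∫ x in a..b, f x ^ s := by
    have hcongr : Set.EqOn (fun x => (f x ^ s - m ^ s) * (f x - m))
        (fun x => f x ^ (s + 1) - m * f x ^ s - m ^ s * (f x - m)) (Set.uIcc a b) := fun x hx => by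
      simp only [Real.rpow_add_one' (hnonneg x (hicc ▸ hx)) (by linarith : s + 1 ≠ 0)]
      ring
    have hcentred : ∫ x in a..b, (f x - m) = 0 := by
      rw [integral_sub (hii hf) intervalIntegrable_const, intervalIntegral.integral_const, hm,
        smul_eq_mul, mul_inv_cancel_left₀ hlen.ne', sub_self]
    rw [integral_congr hcongr, intervalIntegral.integral_sub, intervalIntegral.integral_sub,
      intervalIntegral.integral_const_mul, intervalIntegral.integral_const_mul, hcentred,
      mul_zero, sub_zero]
    exacts [hii (hfs (by linarith)), (hii (hfs hs)).const_mul m,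
      (hii (hfs (by linarith))).sub ((hii (hfs hs)).const_mul m),
      ((hii hf).sub intervalIntegrable_const).const_mul _]
  intro x hx
  by_contra hne
  refine (rpow_sub_rpow_mul_sub_pos (hnonneg x hx) hm0 hs hne).ne' ?_
  refine eqOn_zero_of_integral_nonpos hab
    (((hfs hs).sub continuousOn_const).mul (hf.sub continuousOn_const)) (fun y hy => ?_)
    (hexpand.trans_le (sub_nonpos.mpr hint)) hx
  rcases eq_or_ne (f y) m with hy' | hy'
  · simp [hy']
  · exact (rpow_sub_rpow_mul_sub_pos (hnonneg y hy) hm0 hs hy').le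

end Interval

section Fourier

variable {a b : ℝ}

theorem fourierCoeffOn_ofReal_zero (hab : a < b) (f : ℝ → ℝ) :
    fourierCoeffOn hab (fun x => (f x : ℂ)) 0 = (((b - a)⁻¹ * ∫ x in a..b, f x : ℝ) : ℂ) := by
  simp only [fourierCoeffOn_eq_integral, neg_zero, fourier_zero, smul_eq_mul, one_mul, one_div,
    intervalIntegral.integral_ofReal, Complex.real_smul, Complex.ofReal_mul]

theorem fourierCoeffOn_ofReal_neg (hab : a < b) (f : ℝ → ℝ) (n : ℤ) :
    fourierCoeffOn hab (fun x => (f x : ℂ)) (-n) =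
      conj (fourierCoeffOn hab (fun x => (f x : ℂ)) n) := by
  simp only [fourierCoeffOn_eq_integral, Complex.real_smul, smul_eq_mul, map_mul,
    Complex.conj_ofReal, ← intervalIntegral_conj, ← fourier_neg]

theorem fourierCoeffOn_linear_comb (hab : a < b) {f g : ℝ → ℂ}
    (hf : IntervalIntegrable f volume a b) (hg : IntervalIntegrable g volume a b)
    (c d : ℂ) (n : ℤ) :
    fourierCoeffOn hab (fun x => c * f x + d * g x) n =
      c * fourierCoeffOn hab f n + d * fourierCoeffOn hab g n := by
  have he : ContinuousOn (fun x : ℝ => fourier (-n) (x : AddCircle (b - a))) (Set.uIcc a b) :=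
    ((map_continuous (fourier (-n))).comp (AddCircle.continuous_mk' _)).continuousOn
  have hint : ∀ {h : ℝ → ℂ} (e : ℂ), IntervalIntegrable h volume a b → IntervalIntegrable
      (fun x : ℝ => fourier (-n) (x : AddCircle (b - a)) • (e * h x)) volume a b :=
    fun e hh => (hh.const_mul e).continuousOn_smul he
  rw [← fourierCoeffOn.const_mul, ← fourierCoeffOn.const_mul]
  simp only [fourierCoeffOn_eq_integral, smul_add]
  rw [integral_add (hint c hf) (hint d hg), smul_add]

theorem fourierCoeffOn_sub (hab : a < b) {f g : ℝ → ℂ} (hf : IntervalIntegrable f volume a b)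
    (hg : IntervalIntegrable g volume a b) (n : ℤ) :
    fourierCoeffOn hab (fun x => f x - g x) n =
      fourierCoeffOn hab f n - fourierCoeffOn hab g n := by
  simpa only [one_mul, neg_mul, ← sub_eq_add_neg] using
    fourierCoeffOn_linear_comb hab hf hg 1 (-1) n

theorem ae_eq_of_fourierCoeffOn_eq (hab : a < b) {f g : ℝ → ℂ}
    (hf : MemLp f 2 (volume.restrict (Set.Ioc a b)))
    (hg : MemLp g 2 (volume.restrict (Set.Ioc a b)))
    (h : ∀ n, fourierCoeffOn hab f n = fourierCoeffOn hab g n) :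
    f =ᵐ[volume.restrict (Set.Ioc a b)] g := by
  have hint : ∀ {h : ℝ → ℂ}, MemLp h 2 (volume.restrict (Set.Ioc a b)) →
      IntervalIntegrable h volume a b := fun hh =>
    (intervalIntegrable_iff_integrableOn_Ioc_of_le hab.le).mpr (hh.integrable one_le_two)
  have hsum := hasSum_sq_fourierCoeffOn hab (hf.sub hg)
  have hzero : ∀ n, fourierCoeffOn hab (f - g) n = 0 := fun n => by
    rw [← sub_eq_zero.mpr (h n)]
    exact fourierCoeffOn_sub hab (hint hf) (hint hg) n
  simp only [hzero, norm_zero, ne_eq, OfNat.ofNat_ne_zero, not_false_eq_true, zero_pow] at hsum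
  have hnorm : ∫ x in a..b, ‖(f - g) x‖ ^ 2 = 0 := by
    simpa [sub_ne_zero.mpr hab.ne'] using hsum.unique hasSum_zero
  rw [integral_of_le hab.le, integral_eq_zero_iff_of_nonneg (fun _ => sq_nonneg _)
    (hf.sub hg).norm.integrable_sq] at hnorm
  filter_upwards [hnorm] with x hx
  simpa [sub_eq_zero] using hx

theorem contDiff_fourier {T : ℝ} (n : ℤ) {m : ℕ∞} :
    ContDiff ℝ m fun x : ℝ => fourier n (x : AddCircle T) := by
  simp only [fourier_coe_apply]
  exact (((contDiff_const.mul Complex.ofRealCLM.contDiff).div_const _)).cexp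

theorem fourierCoeffOn_of_integral_by_parts (hab : a < b) {q q' : ℝ → ℝ} {n : ℤ}
    (h : ∫ x in a..b, q x • deriv (fun y : ℝ => fourier (-n) (y : AddCircle (b - a))) x =
      -∫ x in a..b, q' x • fourier (-n) (x : AddCircle (b - a))) :
    fourierCoeffOn hab (fun x => (q' x : ℂ)) n =
      2 * π * Complex.I * n / (b - a) * fourierCoeffOn hab (fun x => (q x : ℂ)) n := by
  have hderiv : ∀ x : ℝ, deriv (fun y : ℝ => fourier (-n) (y : AddCircle (b - a))) x =
      -(2 * π * Complex.I * n / (b - a)) * fourier (-n) (x : AddCircle (b - a)) := fun x => by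
    rw [(hasDerivAt_fourier_neg (b - a) n x).deriv]
    push_cast
    ring
  have hcomm : ∀ f : ℝ → ℝ, ∫ x in a..b, fourier (-n) (x : AddCircle (b - a)) • (f x : ℂ) =
      ∫ x in a..b, f x • fourier (-n) (x : AddCircle (b - a)) := fun f => by
    simp only [smul_eq_mul, mul_comm (fourier (-n) _), Complex.real_smul]
  simp only [hderiv, ← mul_smul_comm, intervalIntegral.integral_const_mul] at h
  rw [fourierCoeffOn_eq_integral, fourierCoeffOn_eq_integral, hcomm, hcomm,
    Complex.real_smul, Complex.real_smul]
  linear_combination ((1 / (b - a) : ℝ) : ℂ) * h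

theorem fourierCoeffOn_of_ae_hasDerivAt (hab : a < b) {q q' : ℝ → ℝ}
    (hq : AbsolutelyContinuousOnInterval q a b)
    (hq' : ∀ᵐ x ∂volume.restrict (Set.Ioc a b), HasDerivAt q (q' x) x) (hper : q a = q b)
    (n : ℤ) :
    fourierCoeffOn hab (fun x => (q' x : ℂ)) n =
      2 * π * Complex.I * n / (b - a) * fourierCoeffOn hab (fun x => (q x : ℂ)) n := by
  have hend : fourier (-n) (b : AddCircle (b - a)) = fourier (-n) (a : AddCircle (b - a)) := by
    rw [← AddCircle.coe_add_period (b - a) a, add_sub_cancel]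
  have hderiv : (fun x => (q' x : ℂ)) =ᵐ[volume.restrict (Set.Ioc a b)]
      fun x => ((deriv q x : ℝ) : ℂ) := by
    filter_upwards [hq'] with x hx
    rw [hx.deriv]
  rw [fourierCoeffOn_congr_ae hab hderiv]
  refine fourierCoeffOn_of_integral_by_parts hab ?_
  rw [integral_smul_deriv_eq_deriv_smul hq (contDiff_fourier (-n)), hper, hend, sub_self, zero_sub]

theorem fourierCoeffOn_const (hab : a < b) (c : ℝ) {n : ℤ} (hn : n ≠ 0) :
    fourierCoeffOn hab (fun _ => (c : ℂ)) n = 0 := by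
  have hlen : (b - a : ℂ) ≠ 0 := by exact_mod_cast sub_ne_zero.mpr hab.ne'
  have hderiv := fourierCoeffOn_of_ae_hasDerivAt hab (q := fun _ => c) (q' := fun _ => 0)
    (ContDiffOn.absolutelyContinuousOnInterval contDiffOn_const)
    (.of_forall fun x => hasDerivAt_const x c) rfl n
  have hzero : fourierCoeffOn hab (fun _ => ((0 : ℝ) : ℂ)) n = 0 := by
    simp [fourierCoeffOn_eq_integral]
  exact (mul_eq_zero.mp (hderiv.symm.trans hzero)).resolve_left
    (by simp [hn, hlen, Real.pi_ne_zero])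

theorem norm_fourierCoeffOn_le_of_ae_hasDerivAt (hab : a < b) {q q' : ℝ → ℝ}
    (hq : AbsolutelyContinuousOnInterval q a b)
    (hq' : ∀ᵐ x ∂volume.restrict (Set.Ioc a b), HasDerivAt q (q' x) x) (hper : q a = q b)
    {n : ℤ} (hn : n ≠ 0) :
    ‖fourierCoeffOn hab (fun x => (q x : ℂ)) n‖ ≤
      (b - a) / (2 * π) * ‖fourierCoeffOn hab (fun x => (q' x : ℂ)) n‖ := by
  have hlen : 0 < b - a := sub_pos.mpr hab
  have hsub : ‖(b - a : ℂ)‖ = b - a := by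
    rw [← Complex.ofReal_sub, Complex.norm_of_nonneg hlen.le]
  have hfactor : ‖(2 * π * Complex.I * n / (b - a) : ℂ)‖ = 2 * π / (b - a) * |(n : ℝ)| := by
    rw [norm_div, norm_mul, norm_mul, norm_mul, hsub, Complex.norm_I, Complex.norm_intCast,
      Complex.norm_two, Complex.norm_of_nonneg Real.pi_pos.le]
    ring
  rw [fourierCoeffOn_of_ae_hasDerivAt hab hq hq' hper, norm_mul, hfactor]
  calc ‖fourierCoeffOn hab (fun x => (q x : ℂ)) n‖
      ≤ |(n : ℝ)| * ‖fourierCoeffOn hab (fun x => (q x : ℂ)) n‖ :=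
        le_mul_of_one_le_left (norm_nonneg _) (by exact_mod_cast Int.one_le_abs hn)
    _ = _ := by field_simp

theorem integral_sq_le_add_integral_deriv_sq (hab : a < b) {q q' : ℝ → ℝ}
    (hq : AbsolutelyContinuousOnInterval q a b)
    (hq' : ∀ᵐ x ∂volume.restrict (Set.Ioc a b), HasDerivAt q (q' x) x) (hper : q a = q b)
    (hL2 : MemLp q' 2 (volume.restrict (Set.Ioc a b))) :
    ∫ x in a..b, q x ^ 2 ≤
      (b - a)⁻¹ * (∫ x in a..b, q x) ^ 2 +
        ((b - a) / (2 * π)) ^ 2 * ∫ x in a..b, q' x ^ 2 := by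
  have hlen : 0 < b - a := sub_pos.mpr hab
  have hqL2 : MemLp q 2 (volume.restrict (Set.Ioc a b)) :=
    memLp_restrict_Ioc_of_continuousOn (Set.uIcc_of_le hab.le ▸ hq.continuousOn)
  have hsum := hasSum_sq_fourierCoeffOn hab (f := fun x => (q x : ℂ)) hqL2.ofReal
  have hsum' := hasSum_sq_fourierCoeffOn hab (f := fun x => (q' x : ℂ)) hL2.ofReal
  have hbound := hasSum_le (fun n => ?_) hsum
    ((hasSum_ite_eq (0 : ℤ) (((b - a)⁻¹ * ∫ x in a..b, q x) ^ 2)).add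
      (hsum'.mul_left (((b - a) / (2 * π)) ^ 2)))
  · simp only [Complex.norm_real, Real.norm_eq_abs, sq_abs, smul_eq_mul] at hbound
    have := mul_le_mul_of_nonneg_left hbound hlen.le
    field_simp at this ⊢
    linarith
  · rcases eq_or_ne n 0 with rfl | hn
    · rw [fourierCoeffOn_ofReal_zero, Complex.norm_real, Real.norm_eq_abs, sq_abs, if_pos rfl]
      exact le_add_of_nonneg_right (by positivity)
    · rw [if_neg hn, zero_add, ← mul_pow]
      gcongr
      exact norm_fourierCoeffOn_le_of_ae_hasDerivAt hab hq hq' hper hn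

theorem ae_eq_const_add_integral_of_fourierCoeffOn (hab : a < b) {g G : ℝ → ℝ}
    (hg : MemLp g 2 (volume.restrict (Set.Ioc a b))) (hG : IntervalIntegrable G volume a b)
    (hgG : ∀ n : ℤ, fourierCoeffOn hab (fun x => (G x : ℂ)) n =
      2 * π * Complex.I * n / (b - a) * fourierCoeffOn hab (fun x => (g x : ℂ)) n) :
    ∃ C : ℝ, g =ᵐ[volume.restrict (Set.Ioc a b)] fun x => C + ∫ t in a..x, G t := by
  have hlen : (b - a : ℂ) ≠ 0 := by exact_mod_cast sub_ne_zero.mpr hab.ne'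
  have hG0 : ∫ x in a..b, G x = 0 := by
    have h0 := hgG 0
    rw [fourierCoeffOn_ofReal_zero] at h0
    simpa [hlen, sub_ne_zero.mpr hab.ne'] using h0
  set C : ℝ := (b - a)⁻¹ * ((∫ x in a..b, g x) - ∫ x in a..b, ∫ t in a..x, G t) with hC
  set K : ℝ → ℝ := fun x => C + ∫ t in a..x, G t with hK
  have hKac := absolutelyContinuousOnInterval_const_add_integral hG C
  have hKL2 : MemLp K 2 (volume.restrict (Set.Ioc a b)) :=
    memLp_restrict_Ioc_of_continuousOn (Set.uIcc_of_le hab.le ▸ hKac.continuousOn)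
  have hcoeff := fourierCoeffOn_of_ae_hasDerivAt hab hKac
    (ae_hasDerivAt_const_add_integral hab.le hG C) (by simp [hG0])
  have hmean : ∫ x in a..b, g x = ∫ x in a..b, K x := by
    have hHac := absolutelyContinuousOnInterval_const_add_integral hG 0
    simp only [zero_add] at hHac
    rw [hK, integral_add intervalIntegrable_const hHac.continuousOn.intervalIntegrable,
      intervalIntegral.integral_const, hC, smul_eq_mul,
      mul_inv_cancel_left₀ (sub_ne_zero.mpr hab.ne'), sub_add_cancel]
  refine ⟨C, ?_⟩
  have heq := ae_eq_of_fourierCoeffOn_eq hab hg.ofReal hKL2.ofReal fun n => ?_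
  · filter_upwards [heq] with x hx
    exact Complex.ofReal_injective hx
  rcases eq_or_ne n 0 with rfl | hn
  · simp only [RCLike.ofReal_eq_complex_ofReal]
    rw [fourierCoeffOn_ofReal_zero, fourierCoeffOn_ofReal_zero, hmean]
  · have hn' : 2 * π * Complex.I * n / (b - a : ℂ) ≠ 0 := by
      simp [hn, hlen, Real.pi_ne_zero]
    exact mul_left_cancel₀ hn' ((hgG n).symm.trans (hcoeff n))

end Fourier

/-! ### Profiles in `H¹` of the circle -/

theorem neg_pi_lt_pi : -π < π := neg_lt_self Real.pi_pos

namespace IsH1Circle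

variable {ψ dψ : ℝ → ℝ}

theorem apply_neg_pi (h : IsH1Circle ψ dψ) : ψ (-π) = ψ π := by
  rw [← h.periodic (-π)]
  ring_nf

theorem intervalIntegrable_deriv (h : IsH1Circle ψ dψ) : IntervalIntegrable dψ volume (-π) π :=
  (intervalIntegrable_iff_integrableOn_Ioc_of_le neg_pi_lt_pi.le).mpr
    (h.deriv_memLp.integrable one_le_two)

theorem intervalIntegrable_deriv_sq (h : IsH1Circle ψ dψ) :
    IntervalIntegrable (fun x => dψ x ^ 2) volume (-π) π :=
  (intervalIntegrable_iff_integrableOn_Ioc_of_le neg_pi_lt_pi.le).mpr h.deriv_memLp.integrable_sq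

theorem memLp_continuous_mul_deriv (h : IsH1Circle ψ dψ) {g : ℝ → ℝ} (hg : Continuous g) :
    MemLp (fun x => g x * dψ x) 2 (volume.restrict (Set.Ioc (-π) π)) :=
  h.deriv_memLp.mul' (memLp_restrict_Ioc_of_continuousOn (p := ⊤) hg.continuousOn)

theorem integral_smul_deriv {E : Type*} [NormedAddCommGroup E] [NormedSpace ℝ E]
    [CompleteSpace E] (h : IsH1Circle ψ dψ) {w : ℝ → E} (hw : ContDiff ℝ ∞ w)
    (hper : Function.Periodic w (2 * π)) :
    ∫ x in (-π)..π, ψ x • deriv w x = -∫ x in (-π)..π, dψ x • w x := by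
  refine (SeparatingDual.eq_iff_forall_dual_eq (R := ℝ)).mpr fun L => ?_
  have hderiv : ∀ x, L (deriv w x) = deriv (fun y => L (w y)) x := fun x =>
    (L.hasFDerivAt.comp_hasDerivAt x
      (hw.differentiable (by simp) x).hasDerivAt).deriv.symm
  have hint : IntervalIntegrable (fun x => ψ x • deriv w x) volume (-π) π :=
    (h.continuous.smul (hw.continuous_deriv (by simp))).intervalIntegrable _ _
  have hint' : IntervalIntegrable (fun x => dψ x • w x) volume (-π) π :=
    h.intervalIntegrable_deriv.smul_continuousOn hw.continuous.continuousOn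
  rw [map_neg, ← L.intervalIntegral_comp_comm hint, ← L.intervalIntegral_comp_comm hint']
  simp only [map_smul, smul_eq_mul, hderiv]
  exact h.weak_deriv _ (L.contDiff.comp hw) fun x => by rw [hper x]

theorem exists_eq_const_add_integral (h : IsH1Circle ψ dψ) :
    ∃ C : ℝ, ∀ x ∈ Set.Icc (-π) π, ψ x = C + ∫ t in (-π)..x, dψ t := by
  obtain ⟨C, hC⟩ := ae_eq_const_add_integral_of_fourierCoeffOn neg_pi_lt_pi
    (memLp_restrict_Ioc_of_continuousOn h.continuous.continuousOn) h.intervalIntegrable_deriv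
    fun n => fourierCoeffOn_of_integral_by_parts neg_pi_lt_pi <|
      h.integral_smul_deriv (contDiff_fourier (-n)) fun x => by
        rw [show x + 2 * π = x + (π - -π) by ring, AddCircle.coe_add_period]
  rw [Measure.restrict_congr_set Ioc_ae_eq_Icc] at hC
  refine ⟨C, Measure.eqOn_Icc_of_ae_eq _ neg_pi_lt_pi.ne hC h.continuous.continuousOn ?_⟩
  rw [← Set.uIcc_of_le neg_pi_lt_pi.le]
  exact (absolutelyContinuousOnInterval_const_add_integral
    h.intervalIntegrable_deriv C).continuousOn

theorem absolutelyContinuousOnInterval (h : IsH1Circle ψ dψ) :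
    AbsolutelyContinuousOnInterval ψ (-π) π := by
  obtain ⟨C, hC⟩ := h.exists_eq_const_add_integral
  refine absolutelyContinuousOnInterval_congr (absolutelyContinuousOnInterval_const_add_integral
    h.intervalIntegrable_deriv C) fun x hx => ?_
  exact (hC x (Set.uIcc_of_le neg_pi_lt_pi.le ▸ hx)).symm

theorem ae_hasDerivAt (h : IsH1Circle ψ dψ) :
    ∀ᵐ x ∂volume.restrict (Set.Ioc (-π) π), HasDerivAt ψ (dψ x) x := by
  obtain ⟨C, hC⟩ := h.exists_eq_const_add_integral
  have hprim := ae_hasDerivAt_const_add_integral neg_pi_lt_pi.le h.intervalIntegrable_deriv C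
  rw [← restrict_Ioo_eq_restrict_Ioc] at hprim ⊢
  filter_upwards [hprim, ae_restrict_mem measurableSet_Ioo] with x hx hxI
  refine hx.congr_of_eventuallyEq ?_
  filter_upwards [Ioo_mem_nhds hxI.1 hxI.2] with y hy
  exact hC y (Set.Ioo_subset_Icc_self hy)

end IsH1Circle

/-! ### The profile equation -/

section Profile

variable {lam k : ℝ} {ψ dψ : ℝ → ℝ}

/-- The right-hand side of the profile equation `λ (ψ ψ')' = (2 λ - 1) ψ'² - λ² ψ² - k` satisfied
by the angular part of a homogeneous stationary flow; `dψ` stands for `ψ'`. -/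
def profileForcing (lam k : ℝ) (ψ dψ : ℝ → ℝ) (x : ℝ) : ℝ :=
  (2 * lam - 1) * dψ x ^ 2 - lam ^ 2 * ψ x ^ 2 - k

/-- Weak solutions on the circle of the profile equation
`λ (ψ ψ')' = (2 λ - 1) ψ'² - λ² ψ² - k`, integrated once: `λ ψ ψ'` agrees almost everywhere with a
periodic primitive of the right-hand side. -/
structure IsProfileSolution (lam k : ℝ) (ψ dψ : ℝ → ℝ) : Prop where
  integral_forcing : ∫ x in (-π)..π, profileForcing lam k ψ dψ x = 0
  exists_ae_eq : ∃ C : ℝ, (fun x => lam * ψ x * dψ x) =ᵐ[volume.restrict (Set.Ioc (-π) π)]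
    fun x => C + ∫ t in (-π)..x, profileForcing lam k ψ dψ t

theorem IsH1Circle.intervalIntegrable_sq (h : IsH1Circle ψ dψ) :
    IntervalIntegrable (fun x => ψ x ^ 2) volume (-π) π :=
  (h.continuous.pow 2).intervalIntegrable _ _

theorem IsH1Circle.intervalIntegrable_deriv_sq_sub (h : IsH1Circle ψ dψ) (lam : ℝ) :
    IntervalIntegrable (fun x => dψ x ^ 2 - lam ^ 2 * ψ x ^ 2) volume (-π) π :=
  h.intervalIntegrable_deriv_sq.sub (h.intervalIntegrable_sq.const_mul _)

theorem IsH1Circle.intervalIntegrable_mul_deriv (h : IsH1Circle ψ dψ) (lam : ℝ) :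
    IntervalIntegrable (fun x => lam * ψ x * dψ x) volume (-π) π :=
  h.intervalIntegrable_deriv.continuousOn_mul (continuous_const.mul h.continuous).continuousOn

theorem IsH1Circle.intervalIntegrable_profileForcing (h : IsH1Circle ψ dψ) :
    IntervalIntegrable (profileForcing lam k ψ dψ) volume (-π) π :=
  ((h.intervalIntegrable_deriv_sq.const_mul _).sub (h.intervalIntegrable_sq.const_mul _)).sub
    intervalIntegrable_const

theorem two_pi_mul_I_mul_div_pi_sub_neg_pi (n : ℤ) :
    (2 * π * Complex.I * n / ((π : ℝ) - (-π : ℝ)) : ℂ) = Complex.I * n := by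
  have hpi : (π : ℂ) ≠ 0 := by exact_mod_cast Real.pi_ne_zero
  push_cast
  field_simp
  ring

theorem IsH1Circle.fourierCoeffOn_mul_deriv (h : IsH1Circle ψ dψ) (n : ℤ) :
    2 * fourierCoeffOn neg_pi_lt_pi (fun x => ((lam * ψ x * dψ x : ℝ) : ℂ)) n =
      Complex.I * n * (lam * fourierCoeffOn neg_pi_lt_pi (fun x => ((ψ x ^ 2 : ℝ) : ℂ)) n) := by
  have hderiv := fourierCoeffOn_of_ae_hasDerivAt neg_pi_lt_pi (q := fun x => lam / 2 * ψ x ^ 2)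
    (q' := fun x => lam * ψ x * dψ x)
    (absolutelyContinuousOnInterval_contDiff_comp (F := fun y => lam / 2 * y ^ 2) (by fun_prop)
      h.absolutelyContinuousOnInterval)
    (h.ae_hasDerivAt.mono fun x hx => ((hx.pow 2).const_mul (lam / 2)).congr_deriv (by ring))
    (by simp only [h.apply_neg_pi]) n
  simp only [Complex.ofReal_mul (lam / 2)] at hderiv
  rw [fourierCoeffOn.const_mul, two_pi_mul_I_mul_div_pi_sub_neg_pi] at hderiv
  rw [hderiv]
  push_cast
  ring

theorem IsH1Circle.fourierCoeffOn_profileForcing (h : IsH1Circle ψ dψ) {n : ℤ} (hn : n ≠ 0) :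
    fourierCoeffOn neg_pi_lt_pi (fun x => (profileForcing lam k ψ dψ x : ℂ)) n =
      (2 * lam - 1) *
          fourierCoeffOn neg_pi_lt_pi (fun x => ((dψ x ^ 2 - lam ^ 2 * ψ x ^ 2 : ℝ) : ℂ)) n +
        2 * lam ^ 2 * (lam - 1) *
          fourierCoeffOn neg_pi_lt_pi (fun x => ((ψ x ^ 2 : ℝ) : ℂ)) n := by
  have hP := intervalIntegrable_ofReal (h.intervalIntegrable_deriv_sq_sub lam)
  have hS := intervalIntegrable_ofReal h.intervalIntegrable_sq
  have hsplit : (fun x => (profileForcing lam k ψ dψ x : ℂ)) = fun x =>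
      ((2 * lam - 1 : ℂ) * ((dψ x ^ 2 - lam ^ 2 * ψ x ^ 2 : ℝ) : ℂ) +
        (2 * lam ^ 2 * (lam - 1) : ℂ) * ((ψ x ^ 2 : ℝ) : ℂ)) - (k : ℂ) := by
    funext x
    rw [profileForcing]
    push_cast
    ring
  rw [hsplit, fourierCoeffOn_sub neg_pi_lt_pi ((hP.const_mul _).add (hS.const_mul _))
    intervalIntegrable_const, fourierCoeffOn_const neg_pi_lt_pi k hn, sub_zero]
  exact fourierCoeffOn_linear_comb neg_pi_lt_pi hP hS _ _ n

theorem IsH1Circle.exists_isProfileSolution (h : IsH1Circle ψ dψ)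
    (hmode : ∀ n : ℤ, n * (2 * lam - 1) *
        fourierCoeffOn neg_pi_lt_pi (fun x => ((dψ x ^ 2 - lam ^ 2 * ψ x ^ 2 : ℝ) : ℂ)) n =
      Complex.I * (4 * lam ^ 2 - 4 * lam + n ^ 2) *
        fourierCoeffOn neg_pi_lt_pi (fun x => ((lam * ψ x * dψ x : ℝ) : ℂ)) n) :
    ∃ k, IsProfileSolution lam k ψ dψ := by
  set k : ℝ := (π - -π)⁻¹ * ∫ x in (-π)..π, profileForcing lam 0 ψ dψ x with hk
  have hlen : π - -π ≠ 0 := sub_ne_zero.mpr neg_pi_lt_pi.ne'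
  have hmean : ∫ x in (-π)..π, profileForcing lam k ψ dψ x = 0 := by
    have hsub : profileForcing lam k ψ dψ = fun x => profileForcing lam 0 ψ dψ x - k := by
      funext x
      simp only [profileForcing, sub_zero]
    rw [hsub, integral_sub h.intervalIntegrable_profileForcing intervalIntegrable_const,
      intervalIntegral.integral_const, hk, smul_eq_mul, mul_inv_cancel_left₀ hlen, sub_self]
  refine ⟨k, hmean, ae_eq_const_add_integral_of_fourierCoeffOn neg_pi_lt_pi
    (h.memLp_continuous_mul_deriv (continuous_const.mul h.continuous))
    h.intervalIntegrable_profileForcing fun n => ?_⟩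
  rw [two_pi_mul_I_mul_div_pi_sub_neg_pi]
  rcases eq_or_ne n 0 with rfl | hn
  · rw [fourierCoeffOn_ofReal_zero, hmean]
    simp
  · have hn' : (n : ℂ) ≠ 0 := by exact_mod_cast hn
    refine mul_left_cancel₀ hn' ?_
    rw [h.fourierCoeffOn_profileForcing hn]
    linear_combination hmode n + 2 * Complex.I * lam * (lam - 1) *
      h.fourierCoeffOn_mul_deriv (lam := lam) n + 2 * lam ^ 2 * (lam - 1) * n *
      fourierCoeffOn neg_pi_lt_pi (fun x => ((ψ x ^ 2 : ℝ) : ℂ)) n * Complex.I_sq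

end Profile

/-! ### Rigidity for `0 < λ < 1 / 2` -/

section Rigidity

variable {lam k : ℝ} {ψ dψ : ℝ → ℝ}

theorem IsH1Circle.absolutelyContinuousOnInterval_comp (h : IsH1Circle ψ dψ) {F F' : ℝ → ℝ}
    (hF : ∀ y, HasDerivAt F (F' y) y) (hF' : Continuous F') :
    AbsolutelyContinuousOnInterval (fun x => F (ψ x)) (-π) π := by
  have hderiv : deriv F = F' := funext fun y => (hF y).deriv
  exact absolutelyContinuousOnInterval_contDiff_comp
    (contDiff_one_iff_deriv.mpr ⟨fun y => (hF y).differentiableAt, hderiv ▸ hF'⟩)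
    h.absolutelyContinuousOnInterval

theorem IsH1Circle.ae_hasDerivAt_comp (h : IsH1Circle ψ dψ) {F F' : ℝ → ℝ}
    (hF : ∀ y, HasDerivAt F (F' y) y) :
    ∀ᵐ x ∂volume.restrict (Set.Ioc (-π) π), HasDerivAt (fun x => F (ψ x)) (F' (ψ x) * dψ x) x :=
  h.ae_hasDerivAt.mono fun x hx => (hF (ψ x)).comp x hx

theorem IsProfileSolution.integral_comp_mul (hs : IsProfileSolution lam k ψ dψ)
    (h : IsH1Circle ψ dψ) {F F' : ℝ → ℝ} (hF : ∀ y, HasDerivAt F (F' y) y)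
    (hF' : Continuous F') :
    ∫ x in (-π)..π, lam * ψ x * dψ x * (F' (ψ x) * dψ x) =
      -∫ x in (-π)..π, profileForcing lam k ψ dψ x * F (ψ x) := by
  obtain ⟨C, hC⟩ := hs.exists_ae_eq
  have hforcing := h.intervalIntegrable_profileForcing (lam := lam) (k := k)
  have hparts := integral_mul_eq_neg_of_ae_hasDerivAt neg_pi_lt_pi.le
    (absolutelyContinuousOnInterval_const_add_integral hforcing C)
    (h.absolutelyContinuousOnInterval_comp hF hF')
    (ae_hasDerivAt_const_add_integral neg_pi_lt_pi.le hforcing C) (h.ae_hasDerivAt_comp hF)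
    (by simp only [integral_same, hs.integral_forcing, h.apply_neg_pi])
  rw [← hparts]
  refine integral_congr_ae_restrict ?_
  rw [Set.uIoc_of_le neg_pi_lt_pi.le]
  filter_upwards [hC] with x hx
  rw [hx]

theorem IsProfileSolution.integral_deriv_sq_mul (hs : IsProfileSolution lam k ψ dψ)
    (h : IsH1Circle ψ dψ) {F F' : ℝ → ℝ} (hF : ∀ y, HasDerivAt F (F' y) y)
    (hF' : Continuous F') :
    ∫ x in (-π)..π, dψ x ^ 2 * (lam * (ψ x * F' (ψ x)) + (2 * lam - 1) * F (ψ x)) =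
      ∫ x in (-π)..π, (lam ^ 2 * ψ x ^ 2 + k) * F (ψ x) := by
  have hψ := h.continuous
  have hFc : Continuous F := continuous_iff_continuousAt.mpr fun y => (hF y).continuousAt
  have hleft : IntervalIntegrable (fun x => lam * ψ x * dψ x * (F' (ψ x) * dψ x))
      volume (-π) π :=
    (h.intervalIntegrable_deriv_sq.mul_continuousOn
      (g := fun x => lam * (ψ x * F' (ψ x))) (by fun_prop)).congr fun x _ => by ring
  have hright : IntervalIntegrable (fun x => profileForcing lam k ψ dψ x * F (ψ x))
      volume (-π) π := h.intervalIntegrable_profileForcing.mul_continuousOn (by fun_prop)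
  have hlow : IntervalIntegrable (fun x => (lam ^ 2 * ψ x ^ 2 + k) * F (ψ x)) volume (-π) π :=
    Continuous.intervalIntegrable (by fun_prop) _ _
  calc ∫ x in (-π)..π, dψ x ^ 2 * (lam * (ψ x * F' (ψ x)) + (2 * lam - 1) * F (ψ x))
      = ∫ x in (-π)..π, (lam * ψ x * dψ x * (F' (ψ x) * dψ x) +
          profileForcing lam k ψ dψ x * F (ψ x) + (lam ^ 2 * ψ x ^ 2 + k) * F (ψ x)) := by
        congr 1
        funext x
        rw [profileForcing]
        ring
    _ = _ := by
        rw [integral_add (hleft.add hright) hlow, integral_add hleft hright,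
          hs.integral_comp_mul h hF hF', neg_add_cancel, zero_add]

theorem IsProfileSolution.integral_regularized_rpow_nonpos (hs : IsProfileSolution lam k ψ dψ)
    (h : IsH1Circle ψ dψ) (hlam : lam ≤ 1 / 2) {β ε : ℝ} (hβ : 2 * lam * β = 1 - 2 * lam)
    (hε : 0 < ε) :
    ∫ x in (-π)..π, (lam ^ 2 * ψ x ^ 2 + k) * (ψ x ^ 2 + ε) ^ β ≤ 0 := by
  have hpos : ∀ y : ℝ, 0 < y ^ 2 + ε := fun y => by positivity
  have hderiv : ∀ y : ℝ, HasDerivAt (fun y : ℝ => (y ^ 2 + ε) ^ β)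
      (2 * y * β * (y ^ 2 + ε) ^ (β - 1)) y := fun y => by
    simpa using ((hasDerivAt_pow 2 y).add_const ε).rpow_const (p := β) (Or.inl (hpos y).ne')
  have hcont : Continuous fun y : ℝ => 2 * y * β * (y ^ 2 + ε) ^ (β - 1) :=
    Continuous.mul (by fun_prop)
      (Continuous.rpow_const (by fun_prop) fun y => Or.inl (hpos y).ne')
  rw [← hs.integral_deriv_sq_mul h hderiv hcont, ← neg_nonneg, ← intervalIntegral.integral_neg]
  refine integral_nonneg neg_pi_lt_pi.le fun x _ => ?_
  have hsplit : (ψ x ^ 2 + ε) ^ β = (ψ x ^ 2 + ε) ^ (β - 1) * (ψ x ^ 2 + ε) := by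
    rw [← Real.rpow_add_one (hpos _).ne', sub_add_cancel]
  calc (0 : ℝ) ≤ dψ x ^ 2 * (ψ x ^ 2 + ε) ^ (β - 1) * ε * (1 - 2 * lam) :=
        mul_nonneg (by have := hpos (ψ x); positivity) (by linarith)
    _ = _ := by
        rw [hsplit]
        linear_combination dψ x ^ 2 * ψ x ^ 2 * (ψ x ^ 2 + ε) ^ (β - 1) * hβ

theorem abs_rpow_eq_mul_sq {p : ℝ} (hp : p ≠ 0) (y : ℝ) : |y| ^ p = |y| ^ (p - 2) * y ^ 2 := by
  have hadd := Real.rpow_add' (abs_nonneg y) (y := p - 2) (z := 2) (by simpa using hp)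
  rwa [sub_add_cancel, Real.rpow_two, sq_abs] at hadd

theorem IsProfileSolution.integral_abs_rpow_nonpos (hs : IsProfileSolution lam k ψ dψ)
    (h : IsH1Circle ψ dψ) {γ : ℝ} (hγ : lam * γ = 1) (hγ' : 2 ≤ γ) :
    lam ^ 2 * (∫ x in (-π)..π, |ψ x| ^ γ) + k * ∫ x in (-π)..π, |ψ x| ^ (γ - 2) ≤ 0 := by
  have hψ := h.continuous
  have hlam : lam ≤ 1 / 2 := by nlinarith
  have hcont : Continuous fun ε : ℝ =>
      ∫ x in (-π)..π, (lam ^ 2 * ψ x ^ 2 + k) * (ψ x ^ 2 + ε) ^ ((γ - 2) / 2) := by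
    refine intervalIntegral.continuous_parametric_intervalIntegral_of_continuous' ?_ _ _
    exact Continuous.mul (by fun_prop)
      (Continuous.rpow_const (by fun_prop) fun _ => Or.inr (by linarith))
  have hlim : ∫ x in (-π)..π, (lam ^ 2 * ψ x ^ 2 + k) * (ψ x ^ 2 + 0) ^ ((γ - 2) / 2) ≤ 0 := by
    refine le_of_tendsto ((hcont.tendsto 0).mono_left (nhdsWithin_le_nhds (s := Set.Ioi 0))) ?_
    filter_upwards [self_mem_nhdsWithin] with ε hε
    exact hs.integral_regularized_rpow_nonpos h hlam (by linear_combination hγ) hε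
  have hpow : ∀ {p : ℝ}, 0 ≤ p → IntervalIntegrable (fun x => |ψ x| ^ p) volume (-π) π :=
    fun hp => (hψ.abs.rpow_const fun _ => Or.inr hp).intervalIntegrable _ _
  rw [← intervalIntegral.integral_const_mul, ← intervalIntegral.integral_const_mul,
    ← intervalIntegral.integral_add ((hpow (by linarith)).const_mul _)
      ((hpow (by linarith)).const_mul _)]
  refine le_of_eq_of_le (congrArg (fun g => ∫ x in (-π)..π, g x) (funext fun x => ?_)) hlim
  rw [abs_rpow_eq_mul_sq (by linarith : γ ≠ 0), add_zero, ← sq_abs (ψ x),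
    ← Real.rpow_natCast_mul (abs_nonneg _), Nat.cast_two, mul_div_cancel₀ _ two_ne_zero]
  ring

theorem IsProfileSolution.integral_abs_rpow_mul_deriv_sq (hs : IsProfileSolution lam k ψ dψ)
    (h : IsH1Circle ψ dψ) {γ : ℝ} (hγ : lam * γ = 1) (hγ' : 2 ≤ γ) :
    ∫ x in (-π)..π, (|ψ x| ^ (γ - 2) * ψ x * dψ x) ^ 2 =
      lam ^ 2 * (∫ x in (-π)..π, (|ψ x| ^ γ) ^ 2) + k * ∫ x in (-π)..π, |ψ x| ^ (2 * γ - 2) := by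
  have hpow : ∀ {p : ℝ}, 0 ≤ p → Continuous fun x => |ψ x| ^ p :=
    fun hp => h.continuous.abs.rpow_const fun _ => Or.inr hp
  have hpow2 : Continuous fun x => (|ψ x| ^ γ) ^ 2 := (hpow (by linarith)).pow 2
  have hsq : ∀ (y p : ℝ), (|y| ^ p) ^ 2 = |y| ^ (2 * p) := fun y p => by
    rw [← Real.rpow_mul_natCast (abs_nonneg _), Nat.cast_two, mul_comm]
  have htest := hs.integral_deriv_sq_mul h
    (fun y => hasDerivAt_abs_rpow y (by linarith : 1 < 2 * γ - 2))
    ((continuous_const.mul (continuous_abs.rpow_const fun _ => Or.inr (by linarith))).mul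
      continuous_id)
  rw [← intervalIntegral.integral_const_mul, ← intervalIntegral.integral_const_mul,
    ← intervalIntegral.integral_add ((hpow2.intervalIntegrable _ _).const_mul _)
      (((hpow (by linarith)).intervalIntegrable _ _).const_mul _)]
  convert htest using 3 with x x
  · rw [abs_rpow_eq_mul_sq (by linarith : 2 * γ - 2 ≠ 0), mul_pow, mul_pow, hsq,
      show 2 * (γ - 2) = 2 * γ - 2 - 2 by ring]
    linear_combination -(2 * dψ x ^ 2 * |ψ x| ^ (2 * γ - 2 - 2) * ψ x ^ 2) * hγ
  · rw [hsq, abs_rpow_eq_mul_sq (by linarith : 2 * γ ≠ 0)]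
    ring

theorem IsH1Circle.integral_abs_rpow_sq_le (h : IsH1Circle ψ dψ) {γ : ℝ} (hγ : 2 ≤ γ) :
    ∫ x in (-π)..π, (|ψ x| ^ γ) ^ 2 ≤ (π - -π)⁻¹ * (∫ x in (-π)..π, |ψ x| ^ γ) ^ 2 +
      γ ^ 2 * ∫ x in (-π)..π, (|ψ x| ^ (γ - 2) * ψ x * dψ x) ^ 2 := by
  have hderiv := fun y : ℝ => hasDerivAt_abs_rpow y (by linarith : 1 < γ)
  have hcont : Continuous fun y : ℝ => γ * |y| ^ (γ - 2) * y :=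
    (continuous_const.mul (continuous_abs.rpow_const fun _ => Or.inr (by linarith))).mul
      continuous_id
  have hwirtinger := integral_sq_le_add_integral_deriv_sq neg_pi_lt_pi
    (h.absolutelyContinuousOnInterval_comp hderiv hcont) (h.ae_hasDerivAt_comp hderiv)
    (by simp only [h.apply_neg_pi]) (h.memLp_continuous_mul_deriv (hcont.comp h.continuous))
  have hlen : (π - -π) / (2 * π) = 1 := by field_simp; norm_num
  rw [hlen, one_pow, one_mul] at hwirtinger
  refine hwirtinger.trans_eq ?_
  rw [← intervalIntegral.integral_const_mul]
  congr 3
  funext x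
  ring

theorem IsProfileSolution.mul_integral_abs_rpow_le (hs : IsProfileSolution lam k ψ dψ)
    (h : IsH1Circle ψ dψ) {γ : ℝ} (hγ : lam * γ = 1) (hγ' : 2 ≤ γ) :
    k * (((π - -π)⁻¹ * ∫ x in (-π)..π, |ψ x| ^ γ) * ∫ x in (-π)..π, |ψ x| ^ (γ - 2)) ≤
      k * ∫ x in (-π)..π, |ψ x| ^ (2 * γ - 2) := by
  have hmean : 0 ≤ (π - -π)⁻¹ * ∫ x in (-π)..π, |ψ x| ^ γ :=
    mul_nonneg (inv_nonneg.mpr (sub_nonneg.mpr neg_pi_lt_pi.le))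
      (integral_nonneg neg_pi_lt_pi.le fun x _ => by positivity)
  have hupper := mul_le_mul_of_nonneg_left (hs.integral_abs_rpow_nonpos h hγ hγ') hmean
  have hlower := mul_le_mul_of_nonneg_left (h.integral_abs_rpow_sq_le hγ') (sq_nonneg lam)
  have hγ2 : lam ^ 2 * γ ^ 2 = 1 := by rw [← mul_pow, hγ, one_pow]
  rw [mul_add, ← mul_assoc (lam ^ 2) (γ ^ 2), hγ2, one_mul,
    hs.integral_abs_rpow_mul_deriv_sq h hγ hγ'] at hlower
  linarith

theorem IsProfileSolution.exists_abs_rpow_eq (hs : IsProfileSolution lam k ψ dψ)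
    (h : IsH1Circle ψ dψ) {γ : ℝ} (hγ : lam * γ = 1) (hγ' : 2 < γ) :
    ∃ c : ℝ, ∀ x ∈ Set.Icc (-π) π, |ψ x| ^ γ = c := by
  have hcont : ContinuousOn (fun x => |ψ x| ^ γ) (Set.Icc (-π) π) :=
    (h.continuous.abs.rpow_const fun _ => Or.inr (by linarith)).continuousOn
  have hnonneg : ∀ {p : ℝ}, ∀ x ∈ Set.Icc (-π) π, 0 ≤ |ψ x| ^ p := fun x _ => by positivity
  have hlam : 0 < lam := pos_of_mul_pos_left (hγ.symm ▸ one_pos) (by linarith)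
  rcases le_or_gt 0 k with hk | hk
  · have hint : 0 ≤ k * ∫ x in (-π)..π, |ψ x| ^ (γ - 2) :=
      mul_nonneg hk (integral_nonneg neg_pi_lt_pi.le hnonneg)
    exact ⟨0, eqOn_zero_of_integral_nonpos neg_pi_lt_pi hcont hnonneg <|
      nonpos_of_mul_nonpos_right (by linarith [hs.integral_abs_rpow_nonpos h hγ hγ'.le])
        (by positivity : 0 < lam ^ 2)⟩
  · have hpow : ∀ x t : ℝ, (|ψ x| ^ γ) ^ t = |ψ x| ^ (γ * t) := fun x t =>
      (Real.rpow_mul (abs_nonneg _) _ _).symm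
    refine ⟨_, eq_mean_of_integral_rpow_add_one_le neg_pi_lt_pi
      (by nlinarith : 0 < 1 - 2 * lam) hcont hnonneg ?_⟩
    simp only [hpow, show γ * (1 - 2 * lam) = γ - 2 by linear_combination -2 * hγ,
      show γ * (1 - 2 * lam + 1) = 2 * γ - 2 by linear_combination -2 * hγ]
    exact (mul_le_mul_left_of_neg hk).mp (hs.mul_integral_abs_rpow_le h hγ hγ'.le)

theorem IsProfileSolution.isRotational (hs : IsProfileSolution lam k ψ dψ)
    (h : IsH1Circle ψ dψ) (hlam : 0 < lam) (hlam' : lam < 1 / 2) : IsRotational ψ := by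
  have hγ : 2 < lam⁻¹ := (lt_inv_comm₀ two_pos hlam).mpr (by rwa [← one_div])
  obtain ⟨c, hc⟩ := hs.exists_abs_rpow_eq h (mul_inv_cancel₀ hlam.ne') hγ
  have habs : ∀ x, |ψ x| = c ^ lam := fun x => by
    obtain ⟨y, hy, hxy⟩ := h.periodic.exists_mem_Ioc Real.two_pi_pos x (-π)
    rw [hxy, ← hc y ⟨hy.1.le, by linarith [hy.2]⟩, Real.rpow_inv_rpow (abs_nonneg _) hlam.ne']
  rcases eq_or_ne (c ^ lam) 0 with hzero | hne
  · exact ⟨0, fun x => abs_eq_zero.mp ((habs x).trans hzero)⟩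
  · rcases isPreconnected_univ.eq_or_eq_neg_of_sq_eq h.continuous.continuousOn
      (continuousOn_const (c := c ^ lam)) (fun x _ => by simp [← habs x]) (fun _ => hne)
      with hpos | hneg
    · exact ⟨c ^ lam, fun x => hpos (Set.mem_univ x)⟩
    · exact ⟨-c ^ lam, fun x => hneg (Set.mem_univ x)⟩

theorem IsRotational.classification (h : IsRotational ψ) :
    IsTrivial lam ψ ∧ ((∀ θ, ψ θ = 0) ∨ IsElliptic ψ) ∧ ¬ IsHyperbolic lam ψ ∧
      ¬ IsParabolic ψ ∧ (IsElliptic ψ → IsRotational ψ) := by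
  obtain ⟨c, hc⟩ := h
  refine ⟨Or.inl ⟨c, hc⟩, ?_, ?_, ?_, fun _ => ⟨c, hc⟩⟩
  · rcases eq_or_ne c 0 with rfl | hne
    · exact Or.inl hc
    · exact Or.inr fun θ => by rwa [hc]
  · rintro ⟨⟨θ, -, -, -, -, hzero, -⟩, hshear⟩
    exact hshear ⟨0, 0, 0, fun x => by rw [hc, ← hc θ, hzero]; simp⟩
  · rintro ⟨θ, ⟨-, hzero⟩, hunique⟩
    have hpi := Real.pi_pos
    have h0 := hunique 0 ⟨⟨by linarith, hpi.le⟩, by rw [hc, ← hc θ, hzero]⟩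
    have hπ := hunique π ⟨⟨by linarith, le_rfl⟩, by rw [hc, ← hc θ, hzero]⟩
    exact hpi.ne (h0.trans hπ.symm)

end Rigidity

/-! ### Radial cutoffs -/

section Radial

variable {f : ℝ → ℝ}

theorem hasCompactSupport_comp_norm_sq {E : Type*} [NormedAddCommGroup E] [ProperSpace E]
    (hf : HasCompactSupport f) : HasCompactSupport fun x : E => f (‖x‖ ^ 2) := by
  rw [hasCompactSupport_iff_eventuallyEq, coclosedCompact_eq_cocompact] at hf ⊢
  have htop : Tendsto (fun x : E => ‖x‖ ^ 2) (cocompact E) atTop :=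
    (tendsto_pow_atTop two_ne_zero).comp tendsto_norm_cocompact_atTop
  exact (htop.mono_right atTop_le_cocompact).eventually hf

theorem zero_notMem_tsupport_comp_norm_sq {E : Type*} [NormedAddCommGroup E]
    (hf : 0 ∉ tsupport f) : (0 : E) ∉ tsupport fun x : E => f (‖x‖ ^ 2) := by
  rw [notMem_tsupport_iff_eventuallyEq] at hf ⊢
  have hcont : Tendsto (fun x : E => ‖x‖ ^ 2) (𝓝 0) (𝓝 0) := by
    simpa using (by fun_prop : Continuous fun x : E => ‖x‖ ^ 2).tendsto 0
  exact hcont.eventually hf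

theorem contDiff_rpow_mul {m : ℕ∞} (hf : ContDiff ℝ m f) (h0 : 0 ∉ tsupport f) (p : ℝ) :
    ContDiff ℝ m fun r => r ^ p * f r := by
  refine contDiff_iff_contDiffAt.mpr fun r => ?_
  rcases eq_or_ne r 0 with rfl | hr
  · have hzero : (fun r => r ^ p * f r) =ᶠ[𝓝 0] fun _ => 0 := by
      filter_upwards [notMem_tsupport_iff_eventuallyEq.mp h0] with r hr
      simp [hr]
    exact contDiffAt_const.congr_of_eventuallyEq hzero
  · exact (Real.contDiffAt_rpow_const_of_ne hr).mul hf.contDiffAt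

theorem integrable_rpow_mul (hf : Continuous f) (hc : HasCompactSupport f) (h0 : 0 ∉ tsupport f)
    (p : ℝ) : Integrable fun r => r ^ p * f r :=
  Continuous.integrable_of_hasCompactSupport
    (contDiff_rpow_mul (m := 0) (contDiff_zero.mpr hf) h0 p).continuous hc.mul_left

theorem integral_Ioi_rpow_mul_deriv (hf : ContDiff ℝ 1 f) (hc : HasCompactSupport f)
    (h0 : 0 ∉ tsupport f) (p : ℝ) :
    ∫ r in Set.Ioi 0, r ^ p * deriv f r = -(p * ∫ r in Set.Ioi 0, r ^ (p - 1) * f r) := by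
  have hderiv : ∀ r ∈ Set.Ioi (0 : ℝ), deriv (fun r => r ^ p * f r) r =
      p * (r ^ (p - 1) * f r) + r ^ p * deriv f r := fun r hr => by
    rw [((Real.hasDerivAt_rpow_const (.inl (Set.mem_Ioi.mp hr).ne')).fun_mul
      (hf.differentiable (by simp) r).hasDerivAt).deriv]
    ring
  have hboundary : ∫ r in Set.Ioi 0, deriv (fun r => r ^ p * f r) r = 0 := by
    rw [HasCompactSupport.integral_Ioi_deriv_eq (contDiff_rpow_mul (m := 1) hf h0 p) hc.mul_left,
      image_eq_zero_of_notMem_tsupport h0, mul_zero, neg_zero]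
  rw [setIntegral_congr_fun measurableSet_Ioi hderiv, MeasureTheory.integral_add
    ((integrable_rpow_mul hf.continuous hc h0 _).integrableOn.const_mul p)
    (integrable_rpow_mul (hf.continuous_deriv le_rfl) hc.deriv
      (fun h => h0 (tsupport_deriv_subset h)) p).integrableOn,
    MeasureTheory.integral_const_mul] at hboundary
  linarith

end Radial

/-- Smooth compactly supported functions that vanish near `0`; composed with `|z|²` they cut off
test fields on the punctured plane. -/
structure IsRadialCutoff (h : ℝ → ℝ) : Prop where
  contDiff : ContDiff ℝ ∞ h
  hasCompactSupport : HasCompactSupport h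
  zero_notMem_tsupport : 0 ∉ tsupport h

theorem IsRadialCutoff.isRadialCutoff_deriv {h : ℝ → ℝ} (hh : IsRadialCutoff h) :
    IsRadialCutoff (deriv h) where
  contDiff := (contDiff_infty_iff_deriv.mp hh.contDiff).2
  hasCompactSupport := hh.hasCompactSupport.deriv
  zero_notMem_tsupport hmem := hh.zero_notMem_tsupport (tsupport_deriv_subset hmem)

theorem exists_isRadialCutoff : ∃ h : ℝ → ℝ, IsRadialCutoff h ∧ (∀ x, 0 ≤ h x) ∧ 0 < h 1 := by
  let h : ContDiffBump (1 : ℝ) := ⟨1 / 4, 1 / 2, by norm_num, by norm_num⟩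
  refine ⟨h, ⟨h.contDiff, h.hasCompactSupport, ?_⟩, fun x => h.nonneg,
    h.pos_of_mem_ball (Metric.mem_ball_self h.rOut_pos)⟩
  rw [h.tsupport_eq, Metric.mem_closedBall]
  norm_num [h]

/-! ### Solenoidal test fields with a single angular mode -/

/-- The solenoidal field `∇^⊥ η` for `η = Re (c * h (|z|²) * z ^ n)`. Multiplication by `I` turns
the gradient `2 ∂η/∂z̄` into `∇^⊥ η`. -/
def modeField (h : ℝ → ℝ) (n : ℕ) (c z : ℂ) : ℂ :=
  Complex.I * (c * deriv h (‖z‖ ^ 2) * z ^ (n + 1) +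
    conj c * (deriv h (‖z‖ ^ 2) * z * conj z ^ n + n * h (‖z‖ ^ 2) * conj z ^ (n - 1)))

/-- The Wirtinger derivative `∂v/∂z̄` of `v = modeField h n c`. -/
def modeFieldConjDeriv (h : ℝ → ℝ) (n : ℕ) (c z : ℂ) : ℂ :=
  Complex.I * (c * deriv (deriv h) (‖z‖ ^ 2) * z ^ (n + 2) +
    conj c * (deriv (deriv h) (‖z‖ ^ 2) * z ^ 2 * conj z ^ n +
      2 * n * deriv h (‖z‖ ^ 2) * z * conj z ^ (n - 1) +
      n * (n - 1) * h (‖z‖ ^ 2) * conj z ^ (n - 2)))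

theorem hasDerivAt_ofReal_comp_norm_sq_line {f : ℝ → ℝ} (hf : Differentiable ℝ f) (z w : ℂ) :
    HasDerivAt (fun t : ℝ => (f (‖z + t • w‖ ^ 2) : ℂ))
      (deriv f (‖z‖ ^ 2) * (z * conj w + conj z * w)) 0 := by
  have hline : HasDerivAt (fun t : ℝ => z + t • w) w 0 := by
    simpa using ((hasDerivAt_id (0 : ℝ)).smul_const w).const_add z
  have hinner : ((2 * inner ℝ z w : ℝ) : ℂ) = z * conj w + conj z * w := by
    rw [Complex.inner, mul_comm (conj z), show z * conj w = conj (w * conj z) by simp [mul_comm],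
      add_comm, Complex.add_conj]
  have hcomp := ((hf (‖z + (0 : ℝ) • w‖ ^ 2)).hasDerivAt.comp (0 : ℝ) hline.norm_sq).ofReal_comp
  simp only [zero_smul, add_zero, Function.comp_apply] at hcomp
  exact hcomp.congr_deriv (by rw [← hinner]; push_cast; ring)

section ModeField

variable {h : ℝ → ℝ}

theorem contDiff_modeField (hh : ContDiff ℝ ∞ h) (n : ℕ) (c : ℂ) :
    ContDiff ℝ ∞ (modeField h n c) := by
  have hconj : ContDiff ℝ ∞ fun z : ℂ => conj z := Complex.conjCLE.contDiff
  have hradial : ∀ {f : ℝ → ℝ}, ContDiff ℝ ∞ f → ContDiff ℝ ∞ fun z : ℂ => (f (‖z‖ ^ 2) : ℂ) :=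
    fun hf => Complex.ofRealCLM.contDiff.comp (hf.comp (contDiff_norm_sq ℝ))
  have hh1 := hradial (f := deriv h) hh.deriv'
  unfold modeField
  fun_prop

theorem exists_hasDerivAt_modeField_line (hh : ContDiff ℝ ∞ h) (n : ℕ) (c z : ℂ) :
    ∃ a : ℝ, ∀ w, HasDerivAt (fun t : ℝ => modeField h n c (z + t • w))
      (a * Complex.I * w + modeFieldConjDeriv h n c z * conj w) 0 := by
  refine ⟨(‖z‖ ^ 2 * deriv (deriv h) (‖z‖ ^ 2) + (n + 1) * deriv h (‖z‖ ^ 2)) *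
    (2 * (c * z ^ n).re), fun w => ?_⟩
  have hz : HasDerivAt (fun t : ℝ => z + t • w) w 0 := by
    simpa using ((hasDerivAt_id (0 : ℝ)).smul_const w).const_add z
  have hconj : HasDerivAt (fun t : ℝ => conj (z + t • w)) (conj w) 0 :=
    Complex.conjCLE.hasFDerivAt.comp_hasDerivAt (0 : ℝ) hz
  have h0 := hasDerivAt_ofReal_comp_norm_sq_line (hh.differentiable (by simp)) z w
  have h1 := hasDerivAt_ofReal_comp_norm_sq_line
    (f := deriv h) (hh.deriv'.differentiable (n := ∞) (by simp)) z w
  have hfield := (((h1.const_mul c).mul (hz.pow (n + 1))).add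
    ((((h1.mul hz).mul (hconj.pow n)).add
      ((h0.const_mul (n : ℂ)).mul (hconj.pow (n - 1)))).const_mul (conj c))).const_mul Complex.I
  refine hfield.congr_deriv ?_
  have hre : ((2 * (c * z ^ n).re : ℝ) : ℂ) = c * z ^ n + conj c * conj z ^ n := by
    rw [← Complex.add_conj, map_mul, map_pow]
  have hnorm : ((‖z‖ ^ 2 : ℝ) : ℂ) = z * conj z := by
    rw [Complex.mul_conj, Complex.normSq_eq_norm_sq]
  simp only [Pi.pow_apply, Pi.mul_apply, zero_smul, add_zero, Complex.ofReal_mul _ (2 * _), hre,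
    modeFieldConjDeriv]
  push_cast at hnorm ⊢
  rw [hnorm]
  rcases n with _ | _ | k
  all_goals
    push_cast
    ring

theorem exists_fderiv_modeField (hh : ContDiff ℝ ∞ h) (n : ℕ) (c z : ℂ) :
    ∃ a : ℝ, ∀ w, fderiv ℝ (modeField h n c) z w =
      a * Complex.I * w + modeFieldConjDeriv h n c z * conj w := by
  obtain ⟨a, ha⟩ := exists_hasDerivAt_modeField_line hh n c z
  have hdiff : DifferentiableAt ℝ (modeField h n c) z :=
    (contDiff_modeField hh n c).differentiable (by simp) z
  exact ⟨a, fun w => hdiff.lineDeriv_eq_fderiv ▸ (ha w).deriv⟩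

theorem inner_fderiv_modeField (hh : ContDiff ℝ ∞ h) (n : ℕ) (c z w : ℂ) :
    inner ℝ (fderiv ℝ (modeField h n c) z w) w =
      (modeFieldConjDeriv h n c z * conj w ^ 2).re := by
  obtain ⟨a, ha⟩ := exists_fderiv_modeField hh n c z
  rw [ha, Complex.inner]
  simp only [map_add, map_mul, Complex.conj_ofReal, Complex.conj_I, Complex.conj_conj]
  simp only [sq, Complex.mul_re, Complex.mul_im, Complex.add_re, Complex.add_im, Complex.neg_re,
    Complex.neg_im, Complex.conj_re, Complex.conj_im, Complex.ofReal_re, Complex.ofReal_im,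
    Complex.I_re, Complex.I_im]
  ring

theorem modeField_eventuallyEq_zero {l : Filter ℂ} (n : ℕ) (c : ℂ)
    (hl : ∀ᶠ z in l, h (‖z‖ ^ 2) = 0) (hl' : ∀ᶠ z in l, deriv h (‖z‖ ^ 2) = 0) :
    modeField h n c =ᶠ[l] 0 := by
  filter_upwards [hl, hl'] with z hz hz'
  simp [modeField, hz, hz']

/-- `modeField` as a test field on the punctured plane. -/
def modeTestField (h : ℝ → ℝ) (hh : IsRadialCutoff h) (n : ℕ) (c : ℂ) : 𝓓(puncturedPlane, ℂ) where
  toFun := modeField h n c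
  contDiff' := contDiff_modeField hh.contDiff n c
  hasCompactSupport' := by
    have hzero : ∀ {f : ℝ → ℝ}, IsRadialCutoff f →
        ∀ᶠ z : ℂ in coclosedCompact ℂ, f (‖z‖ ^ 2) = 0 := fun hf =>
      hasCompactSupport_iff_eventuallyEq.mp (hasCompactSupport_comp_norm_sq hf.hasCompactSupport)
    exact hasCompactSupport_iff_eventuallyEq.mpr
      (modeField_eventuallyEq_zero n c (hzero hh) (hzero hh.isRadialCutoff_deriv))
  tsupport_subset' := by
    have hzero : ∀ {f : ℝ → ℝ}, IsRadialCutoff f → ∀ᶠ z in 𝓝 (0 : ℂ), f (‖z‖ ^ 2) = 0 := fun hf =>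
      notMem_tsupport_iff_eventuallyEq.mp
        (zero_notMem_tsupport_comp_norm_sq hf.zero_notMem_tsupport)
    exact Set.subset_compl_singleton_iff.mpr (notMem_tsupport_iff_eventuallyEq.mpr
      (modeField_eventuallyEq_zero n c (hzero hh) (hzero hh.isRadialCutoff_deriv)))

theorem divergence_modeTestField (hh : IsRadialCutoff h) (n : ℕ) (c : ℂ) :
    divergence (modeTestField h hh n c) = 0 := by
  ext z
  obtain ⟨a, ha⟩ := exists_fderiv_modeField hh.contDiff n c z
  rw [divergence_apply]
  change (fderiv ℝ (modeField h n c) z 1).re + (fderiv ℝ (modeField h n c) z Complex.I).im = 0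
  simp [ha]

theorem modeFieldConjDeriv_mul_conj_sq (n : ℕ) (c : ℂ) (r : ℝ) {E : ℂ} (hE : ‖E‖ = 1) :
    modeFieldConjDeriv h n c (r * E) * conj E ^ 2 =
      Complex.I * (c * (deriv (deriv h) (r ^ 2) * r ^ (n + 2) : ℝ) * E ^ n +
        conj c * (deriv (deriv h) (r ^ 2) * r ^ (n + 2) + 2 * n * deriv h (r ^ 2) * r ^ n +
          n * (n - 1) * h (r ^ 2) * r ^ (n - 2) : ℝ) * conj E ^ n) := by
  have hunit : E * conj E = 1 := by
    rw [Complex.mul_conj, Complex.normSq_eq_norm_sq, hE, one_pow, Complex.ofReal_one]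
  have hnorm : ‖(r : ℂ) * E‖ ^ 2 = r ^ 2 := by
    rw [norm_mul, hE, mul_one, Complex.norm_real, Real.norm_eq_abs, sq_abs]
  simp only [modeFieldConjDeriv, hnorm, map_mul, Complex.conj_ofReal]
  have hpow : (r * E) ^ (n + 2) * conj E ^ 2 = r ^ (n + 2) * E ^ n := by
    linear_combination r ^ (n + 2) * E ^ n * (E * conj E + 1) * hunit
  have hpow_conj : (r * E) ^ 2 * (r * conj E) ^ n * conj E ^ 2 = r ^ (n + 2) * conj E ^ n := by
    linear_combination r ^ (n + 2) * conj E ^ n * (E * conj E + 1) * hunit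
  have hpow_sub_one : n * (r * E) * (r * conj E) ^ (n - 1) * conj E ^ 2 =
      n * r ^ n * conj E ^ n := by
    rcases n with _ | k
    · simp
    · rw [Nat.add_sub_cancel]
      linear_combination (k + 1 : ℕ) * r ^ (k + 1) * conj E ^ (k + 1) * hunit
  have hpow_sub_two : n * (n - 1) * (r * conj E) ^ (n - 2) * conj E ^ 2 =
      n * (n - 1) * r ^ (n - 2) * conj E ^ n := by
    rcases n with _ | _ | k
    · simp
    · simp
    · rw [show k + 1 + 1 - 2 = k by lia]
      ring
  push_cast
  linear_combination Complex.I * c * (deriv (deriv h) (r ^ 2) : ℝ) * hpow +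
    Complex.I * conj c * ((deriv (deriv h) (r ^ 2) : ℝ) * hpow_conj +
      2 * (deriv h (r ^ 2) : ℝ) * hpow_sub_one + h (r ^ 2) * hpow_sub_two)

end ModeField

/-! ### The momentum equation mode by mode -/

section Momentum

variable {h : ℝ → ℝ} {lam : ℝ} {ψ dψ : ℝ → ℝ}

theorem radialVec_eq_exp (θ : ℝ) : radialVec θ = Complex.exp (θ * Complex.I) :=
  Complex.ext (Complex.exp_ofReal_mul_I_re θ).symm (Complex.exp_ofReal_mul_I_im θ).symm

theorem angularVec_eq_I_mul_exp (θ : ℝ) :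
    angularVec θ = Complex.I * Complex.exp (θ * Complex.I) := by
  refine Complex.ext ?_ ?_
  · rw [Complex.I_mul_re, Complex.exp_ofReal_mul_I_im, angularVec]
  · rw [Complex.I_mul_im, Complex.exp_ofReal_mul_I_re, angularVec]

theorem homVelocity_ofReal_mul_exp (lam : ℝ) (ψ dψ : ℝ → ℝ) {r θ : ℝ} (hr : 0 < r)
    (hθ : θ ∈ Set.Ioc (-π) π) :
    homVelocity lam ψ dψ (r * Complex.exp (θ * Complex.I)) =
      (r ^ (lam - 1) : ℝ) * (Complex.exp (θ * Complex.I) * (-dψ θ + lam * ψ θ * Complex.I)) := by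
  have harg : Complex.arg (r * Complex.exp (θ * Complex.I)) = θ := by
    rw [Complex.exp_mul_I]
    exact Complex.arg_mul_cos_add_sin_mul_I hr hθ
  have hnorm : ‖(r : ℂ) * Complex.exp (θ * Complex.I)‖ = r := by
    rw [norm_mul, Complex.norm_exp_ofReal_mul_I, mul_one, Complex.norm_real,
      Real.norm_of_nonneg hr.le]
  rw [homVelocity, harg, hnorm, angularVec_eq_I_mul_exp, radialVec_eq_exp]
  simp only [Complex.real_smul]
  push_cast
  ring

/-- The angular part of the square of the conjugate velocity:
`ū² = r ^ (2 λ - 2) e ^ (- 2 i θ) (ψ' + i λ ψ)²` for `u = homVelocity λ ψ ψ'`. -/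
def conjVelocitySq (lam : ℝ) (ψ dψ : ℝ → ℝ) (θ : ℝ) : ℂ := (dψ θ + lam * ψ θ * Complex.I) ^ 2

/-- For `s = 2 λ + n - 1`, the radial factor of the mode `exp (i n θ)` in the momentum density
`r ⟪Dv u, u⟫` of `v = modeField h n 1`, up to a constant. -/
def radialWeight (h : ℝ → ℝ) (s r : ℝ) : ℝ := r ^ (s + 2) * deriv (deriv h) (r ^ 2)

/-- The counterpart of `radialWeight` for the mode `exp (- i n θ)`. -/
def radialConjWeight (h : ℝ → ℝ) (n : ℕ) (s r : ℝ) : ℝ :=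
  radialWeight h s r + 2 * n * (r ^ s * deriv h (r ^ 2)) + n * (n - 1) * (r ^ (s - 2) * h (r ^ 2))

namespace IsRadialCutoff

theorem integrable_rpow_mul_comp_sq (hh : IsRadialCutoff h) (p : ℝ) :
    Integrable fun r => r ^ p * h (r ^ 2) := by
  simpa only [Real.norm_eq_abs, sq_abs] using
    integrable_rpow_mul (f := fun r => h (‖r‖ ^ 2))
      (hh.contDiff.continuous.comp (by fun_prop))
      (hasCompactSupport_comp_norm_sq hh.hasCompactSupport)
      (zero_notMem_tsupport_comp_norm_sq hh.zero_notMem_tsupport) p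

theorem integral_Ioi_rpow_mul_deriv_comp_sq (hh : IsRadialCutoff h) (p : ℝ) :
    ∫ r in Set.Ioi 0, r ^ p * deriv h (r ^ 2) =
      -((p - 1) / 2 * ∫ r in Set.Ioi 0, r ^ (p - 2) * h (r ^ 2)) := by
  have hdiff : ContDiff ℝ 1 h := hh.contDiff.of_le (by simp)
  have hsq : (fun r : ℝ => h (‖r‖ ^ 2)) = fun r => h (r ^ 2) := by
    simp only [Real.norm_eq_abs, sq_abs]
  have hparts := integral_Ioi_rpow_mul_deriv (f := fun r => h (r ^ 2))
    (hdiff.comp (contDiff_id.pow 2))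
    (hsq ▸ hasCompactSupport_comp_norm_sq hh.hasCompactSupport)
    (hsq ▸ zero_notMem_tsupport_comp_norm_sq hh.zero_notMem_tsupport) (p - 1)
  have hchain : ∀ r ∈ Set.Ioi (0 : ℝ),
      r ^ (p - 1) * deriv (fun r => h (r ^ 2)) r = 2 * (r ^ p * deriv h (r ^ 2)) := fun r hr => by
    have hcomp := (hdiff.differentiable (by simp) (r ^ 2)).hasDerivAt.comp r (hasDerivAt_pow 2 r)
    rw [show deriv (fun r => h (r ^ 2)) r = _ from hcomp.deriv,
      Real.rpow_sub_one (Set.mem_Ioi.mp hr).ne']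
    have hr0 : r ≠ 0 := (Set.mem_Ioi.mp hr).ne'
    field_simp
    push_cast
    ring
  rw [setIntegral_congr_fun measurableSet_Ioi hchain, MeasureTheory.integral_const_mul,
    sub_sub, one_add_one_eq_two] at hparts
  linarith

theorem integral_Ioi_rpow_mul_comp_sq_pos (hh : IsRadialCutoff h) (hnonneg : ∀ x, 0 ≤ h x)
    (hpos : 0 < h 1) (p : ℝ) :
    0 < ∫ r in Set.Ioi 0, r ^ p * h (r ^ 2) := by
  rw [setIntegral_pos_iff_support_of_nonneg_ae
    ((ae_restrict_mem measurableSet_Ioi).mono fun r hr =>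
      mul_nonneg (Real.rpow_nonneg (Set.mem_Ioi.mp hr).le p) (hnonneg _))
    (hh.integrable_rpow_mul_comp_sq p).integrableOn]
  have hsupport : Function.support (fun r : ℝ => r ^ p * h (r ^ 2)) ∩ Set.Ioi 0 =
      {r | h (r ^ 2) ≠ 0} ∩ Set.Ioi 0 := by
    ext r
    simp only [Set.mem_inter_iff, Function.mem_support, Set.mem_ofPred_eq, Set.mem_Ioi,
      and_congr_left_iff]
    intro hr
    simp [(Real.rpow_pos_of_pos hr p).ne']
  rw [hsupport]
  have hopen : IsOpen {r : ℝ | h (r ^ 2) ≠ 0} :=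
    isOpen_ne_fun (hh.contDiff.continuous.comp (by fun_prop)) continuous_const
  exact (hopen.inter isOpen_Ioi).measure_pos volume
    ⟨1, by simpa using hpos.ne', Set.mem_Ioi.mpr one_pos⟩

theorem integrable_radialWeight (hh : IsRadialCutoff h) (s : ℝ) : Integrable (radialWeight h s) :=
  hh.isRadialCutoff_deriv.isRadialCutoff_deriv.integrable_rpow_mul_comp_sq _

theorem integrable_radialConjWeight (hh : IsRadialCutoff h) (n : ℕ) (s : ℝ) :
    Integrable (radialConjWeight h n s) :=
  ((hh.integrable_radialWeight s).add
    ((hh.isRadialCutoff_deriv.integrable_rpow_mul_comp_sq s).const_mul _)).add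
    ((hh.integrable_rpow_mul_comp_sq _).const_mul _)

theorem integral_radialWeight (hh : IsRadialCutoff h) (s : ℝ) :
    ∫ r in Set.Ioi 0, radialWeight h s r =
      (s + 1) * (s - 1) / 4 * ∫ r in Set.Ioi 0, r ^ (s - 2) * h (r ^ 2) := by
  unfold radialWeight
  rw [hh.isRadialCutoff_deriv.integral_Ioi_rpow_mul_deriv_comp_sq, add_sub_cancel_right,
    hh.integral_Ioi_rpow_mul_deriv_comp_sq]
  ring

theorem integral_radialConjWeight (hh : IsRadialCutoff h) (n : ℕ) (s : ℝ) :
    ∫ r in Set.Ioi 0, radialConjWeight h n s r =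
      ((s + 1) * (s - 1) / 4 - n * (s - 1) + n * (n - 1)) *
        ∫ r in Set.Ioi 0, r ^ (s - 2) * h (r ^ 2) := by
  have hint : IntegrableOn (radialWeight h s) (Set.Ioi 0) :=
    (hh.integrable_radialWeight s).integrableOn
  have hint1 : IntegrableOn (fun r => 2 * n * (r ^ s * deriv h (r ^ 2))) (Set.Ioi 0) :=
    ((hh.isRadialCutoff_deriv.integrable_rpow_mul_comp_sq s).const_mul _).integrableOn
  have hint0 : IntegrableOn (fun r => n * (n - 1) * (r ^ (s - 2) * h (r ^ 2))) (Set.Ioi 0) :=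
    ((hh.integrable_rpow_mul_comp_sq (s - 2)).const_mul _).integrableOn
  have hint01 : IntegrableOn (fun r => radialWeight h s r + 2 * n * (r ^ s * deriv h (r ^ 2)))
    (Set.Ioi 0) := hint.add hint1
  simp only [radialConjWeight]
  rw [MeasureTheory.integral_add hint01 hint0, MeasureTheory.integral_add hint hint1,
    MeasureTheory.integral_const_mul, MeasureTheory.integral_const_mul,
    hh.integral_radialWeight, hh.integral_Ioi_rpow_mul_deriv_comp_sq]
  ring

end IsRadialCutoff

theorem mul_rpow_sq_mul_pow {r : ℝ} (hr : 0 < r) (lam : ℝ) (k : ℕ) :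
    r * (r ^ (lam - 1)) ^ 2 * r ^ k = r ^ (2 * lam - 1 + k) := by
  rw [← Real.rpow_natCast r k, ← Real.rpow_mul_natCast hr.le]
  nth_rewrite 1 [← Real.rpow_one r]
  rw [← Real.rpow_add hr, ← Real.rpow_add hr]
  congr 1
  push_cast
  ring

theorem mul_rpow_sq_mul_eq_radialWeight {r : ℝ} (hr : 0 < r) (lam : ℝ) (n : ℕ) :
    r * (r ^ (lam - 1)) ^ 2 * (deriv (deriv h) (r ^ 2) * r ^ (n + 2)) =
      radialWeight h (2 * lam + n - 1) r := by
  have hpow := mul_rpow_sq_mul_pow hr lam (n + 2)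
  rw [show 2 * lam - 1 + ((n + 2 : ℕ) : ℝ) = 2 * lam + n - 1 + 2 by push_cast; ring] at hpow
  rw [radialWeight, ← hpow]
  ring

theorem mul_rpow_sq_mul_eq_radialConjWeight {r : ℝ} (hr : 0 < r) (lam : ℝ) (n : ℕ) :
    r * (r ^ (lam - 1)) ^ 2 * (deriv (deriv h) (r ^ 2) * r ^ (n + 2) +
        2 * n * deriv h (r ^ 2) * r ^ n + n * (n - 1) * h (r ^ 2) * r ^ (n - 2)) =
      radialConjWeight h n (2 * lam + n - 1) r := by
  have hpow : r * (r ^ (lam - 1)) ^ 2 * r ^ n = r ^ (2 * lam + n - 1) := by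
    rw [mul_rpow_sq_mul_pow hr, sub_add_eq_add_sub]
  have hpow_sub_two : n * (n - 1) * (r * (r ^ (lam - 1)) ^ 2 * r ^ (n - 2)) =
      n * (n - 1) * r ^ (2 * lam + n - 1 - 2) := by
    rcases n with _ | _ | k
    · simp
    · simp
    · rw [mul_rpow_sq_mul_pow hr, show k + 1 + 1 - 2 = k by lia]
      push_cast
      ring_nf
  rw [radialConjWeight, ← mul_rpow_sq_mul_eq_radialWeight hr]
  linear_combination 2 * n * deriv h (r ^ 2) * hpow + h (r ^ 2) * hpow_sub_two

theorem inner_fderiv_modeField_polarCoord_symm (hh : ContDiff ℝ ∞ h) (n : ℕ) (c : ℂ)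
    {r θ : ℝ} (hr : 0 < r) (hθ : θ ∈ Set.Ioc (-π) π) :
    r • inner ℝ (fderiv ℝ (modeField h n c) (Complex.polarCoord.symm (r, θ))
        (homVelocity lam ψ dψ (Complex.polarCoord.symm (r, θ))))
        (homVelocity lam ψ dψ (Complex.polarCoord.symm (r, θ))) =
      (Complex.I * (c * (radialWeight h (2 * lam + n - 1) r *
          (Complex.exp (θ * Complex.I) ^ n * conjVelocitySq lam ψ dψ θ)) +
        conj c * (radialConjWeight h n (2 * lam + n - 1) r *
          (conj (Complex.exp (θ * Complex.I)) ^ n * conjVelocitySq lam ψ dψ θ)))).re := by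
  have hpolar : Complex.polarCoord.symm (r, θ) = r * Complex.exp (θ * Complex.I) := by
    rw [Complex.polarCoord_symm_apply, Complex.exp_mul_I, Complex.ofReal_cos, Complex.ofReal_sin]
  have hweight := mul_rpow_sq_mul_eq_radialWeight (h := h) hr lam n
  have hweight_conj := mul_rpow_sq_mul_eq_radialConjWeight (h := h) hr lam n
  rw [hpolar, inner_fderiv_modeField hh, homVelocity_ofReal_mul_exp lam ψ dψ hr hθ, smul_eq_mul,
    ← Complex.re_ofReal_mul]
  congr 1
  have hfield := modeFieldConjDeriv_mul_conj_sq (h := h) n c r (Complex.norm_exp_ofReal_mul_I θ)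
  rw [← hweight, ← hweight_conj, conjVelocitySq]
  simp only [map_mul, map_add, map_neg, Complex.conj_ofReal, Complex.conj_I]
  push_cast at hfield ⊢
  linear_combination (r * (r ^ (lam - 1) : ℝ) ^ 2) * (dψ θ + lam * ψ θ * Complex.I) ^ 2 * hfield

theorem setIntegral_polarCoord_target_mul (f g : ℝ → ℂ) :
    ∫ q in polarCoord.target, f q.1 * g q.2 =
      (∫ r in Set.Ioi 0, f r) * ∫ θ in (-π)..π, g θ := by
  rw [polarCoord_target, Measure.volume_eq_prod, setIntegral_prod_mul,
    intervalIntegral.integral_of_le neg_pi_lt_pi.le, integral_Ioc_eq_integral_Ioo]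

theorem integrableOn_polarCoord_target_mul {f g : ℝ → ℂ} (hf : IntegrableOn f (Set.Ioi 0))
    (hg : IntervalIntegrable g volume (-π) π) :
    IntegrableOn (fun q : ℝ × ℝ => f q.1 * g q.2) polarCoord.target := by
  rw [polarCoord_target, IntegrableOn, Measure.volume_eq_prod, ← Measure.prod_restrict]
  exact hf.mul_prod ((intervalIntegrable_iff_integrableOn_Ioo_of_le neg_pi_lt_pi.le).mp hg)

theorem eq_neg_conj_of_forall_re_mul_add_conj_mul_eq_zero {A B : ℂ}
    (hAB : ∀ c : ℂ, (c * A + conj c * B).re = 0) : A = -conj B := by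
  have h1 := hAB 1
  have hI := hAB Complex.I
  simp only [map_one, one_mul, Complex.conj_I, neg_mul, Complex.add_re, Complex.neg_re,
    Complex.I_mul_re] at h1 hI
  refine Complex.ext ?_ ?_
  · simp only [Complex.neg_re, Complex.conj_re]
    linarith
  · simp only [Complex.neg_im, Complex.conj_im]
    linarith

theorem conjVelocitySq_eq (lam : ℝ) (ψ dψ : ℝ → ℝ) (θ : ℝ) :
    conjVelocitySq lam ψ dψ θ = ((dψ θ ^ 2 - lam ^ 2 * ψ θ ^ 2 : ℝ) : ℂ) +
      2 * Complex.I * ((lam * ψ θ * dψ θ : ℝ) : ℂ) := by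
  rw [conjVelocitySq]
  push_cast
  linear_combination (lam * ψ θ) ^ 2 * Complex.I_sq

theorem IsH1Circle.intervalIntegrable_conjVelocitySq (hψ : IsH1Circle ψ dψ) (lam : ℝ) :
    IntervalIntegrable (conjVelocitySq lam ψ dψ) volume (-π) π := by
  rw [funext (conjVelocitySq_eq lam ψ dψ)]
  exact (intervalIntegrable_ofReal (hψ.intervalIntegrable_deriv_sq_sub lam)).add
    ((intervalIntegrable_ofReal (hψ.intervalIntegrable_mul_deriv lam)).const_mul _)

theorem integral_inner_fderiv_modeField (hh : IsRadialCutoff h) (hψ : IsH1Circle ψ dψ) (n : ℕ)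
    (c : ℂ) :
    ∫ z, inner ℝ (fderiv ℝ (modeField h n c) z (homVelocity lam ψ dψ z)) (homVelocity lam ψ dψ z) =
      (Complex.I *
        (c * ((∫ r in Set.Ioi 0, (radialWeight h (2 * lam + n - 1) r : ℂ)) *
            ∫ θ in (-π)..π, Complex.exp (θ * Complex.I) ^ n * conjVelocitySq lam ψ dψ θ) +
          conj c * ((∫ r in Set.Ioi 0, (radialConjWeight h n (2 * lam + n - 1) r : ℂ)) *
            ∫ θ in (-π)..π, conj (Complex.exp (θ * Complex.I)) ^ n *
              conjVelocitySq lam ψ dψ θ))).re := by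
  have hweight : IntegrableOn (fun r => (radialWeight h (2 * lam + n - 1) r : ℂ)) (Set.Ioi 0) :=
    (hh.integrable_radialWeight _).ofReal.integrableOn
  have hweight_conj : IntegrableOn (fun r => (radialConjWeight h n (2 * lam + n - 1) r : ℂ))
      (Set.Ioi 0) := (hh.integrable_radialConjWeight n _).ofReal.integrableOn
  have hdensity := integrableOn_polarCoord_target_mul hweight
    ((hψ.intervalIntegrable_conjVelocitySq lam).continuousOn_mul
      (g := fun θ => Complex.exp (θ * Complex.I) ^ n) (by fun_prop))
  have hdensity_conj := integrableOn_polarCoord_target_mul hweight_conj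
    ((hψ.intervalIntegrable_conjVelocitySq lam).continuousOn_mul
      (g := fun θ => conj (Complex.exp (θ * Complex.I)) ^ n)
      ((Complex.continuous_conj.comp (by fun_prop)).pow n).continuousOn)
  rw [← Complex.integral_comp_polarCoord_symm,
    setIntegral_congr_fun polarCoord.open_target.measurableSet
      fun q hq => inner_fderiv_modeField_polarCoord_symm hh.contDiff n c hq.1
        (Set.Ioo_subset_Ioc_self hq.2),
    ← setIntegral_polarCoord_target_mul, ← setIntegral_polarCoord_target_mul,
    ← MeasureTheory.integral_const_mul, ← MeasureTheory.integral_const_mul,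
    ← MeasureTheory.integral_add (hdensity.const_mul c) (hdensity_conj.const_mul (conj c)),
    ← MeasureTheory.integral_const_mul]
  exact Complex.reCLM.integral_comp_comm
    (((hdensity.const_mul c).add (hdensity_conj.const_mul (conj c))).const_mul Complex.I)

theorem IsWeakStationaryEuler.integral_exp_pow_mul_conjVelocitySq {p : 𝓓'(puncturedPlane, ℝ)}
    (hE : IsWeakStationaryEuler puncturedPlane (homVelocity lam ψ dψ) p) (hψ : IsH1Circle ψ dψ)
    (n : ℕ) :
    (2 * lam + n) * (2 * lam + n - 2) *
        ∫ θ in (-π)..π, Complex.exp (θ * Complex.I) ^ n * conjVelocitySq lam ψ dψ θ =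
      (2 * lam - n) * (2 * lam - n - 2) *
        ∫ θ in (-π)..π, Complex.exp (θ * Complex.I) ^ n * conj (conjVelocitySq lam ψ dψ θ) := by
  obtain ⟨h, hh, hnonneg, hpos⟩ := exists_isRadialCutoff
  have hpair := eq_neg_conj_of_forall_re_mul_add_conj_mul_eq_zero fun c => by
    have hmomentum := hE.momentum (modeTestField h hh n c)
    rw [divergence_modeTestField, map_zero, add_zero] at hmomentum
    have hint := (integral_inner_fderiv_modeField hh hψ n c).symm.trans hmomentum
    rw [mul_add, mul_left_comm, mul_left_comm Complex.I (conj c)] at hint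
    exact hint
  have hM := hh.integral_Ioi_rpow_mul_comp_sq_pos hnonneg hpos (2 * lam + n - 1 - 2)
  set M := ∫ r in Set.Ioi 0, r ^ (2 * lam + n - 1 - 2) * h (r ^ 2)
  have hM' : (M : ℂ) ≠ 0 := by exact_mod_cast hM.ne'
  have hconj : conj (∫ θ in (-π)..π, conj (Complex.exp (θ * Complex.I)) ^ n *
      conjVelocitySq lam ψ dψ θ) =
      ∫ θ in (-π)..π, Complex.exp (θ * Complex.I) ^ n * conj (conjVelocitySq lam ψ dψ θ) := by
    rw [← intervalIntegral_conj]
    simp only [map_mul, map_pow, Complex.conj_conj]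
  rw [integral_complex_ofReal, integral_complex_ofReal, hh.integral_radialWeight,
    hh.integral_radialConjWeight, map_mul, map_mul, hconj, Complex.conj_I,
    Complex.conj_ofReal] at hpair
  refine mul_left_cancel₀ (mul_ne_zero Complex.I_ne_zero hM') ?_
  push_cast at hpair
  linear_combination 4 * hpair

theorem fourierCoeffOn_neg_pi_pi_neg_natCast (f : ℝ → ℂ) (n : ℕ) :
    fourierCoeffOn neg_pi_lt_pi f (-n) =
      (1 / (π - -π) : ℝ) * ∫ θ in (-π)..π, Complex.exp (θ * Complex.I) ^ n * f θ := by
  rw [fourierCoeffOn_eq_integral, Complex.real_smul]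
  congr 1
  refine intervalIntegral.integral_congr fun θ _ => ?_
  have hpi : (π : ℂ) ≠ 0 := by exact_mod_cast Real.pi_ne_zero
  rw [smul_eq_mul, fourier_coe_apply, ← Complex.exp_nat_mul]
  congr 2
  push_cast
  field_simp
  ring

theorem IsWeakStationaryEuler.fourierCoeffOn_neg_natCast {p : 𝓓'(puncturedPlane, ℝ)}
    (hE : IsWeakStationaryEuler puncturedPlane (homVelocity lam ψ dψ) p) (hψ : IsH1Circle ψ dψ)
    (n : ℕ) :
    -n * (2 * lam - 1) *
        fourierCoeffOn neg_pi_lt_pi (fun x => ((dψ x ^ 2 - lam ^ 2 * ψ x ^ 2 : ℝ) : ℂ)) (-n) =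
      Complex.I * (4 * lam ^ 2 - 4 * lam + n ^ 2) *
        fourierCoeffOn neg_pi_lt_pi (fun x => ((lam * ψ x * dψ x : ℝ) : ℂ)) (-n) := by
  have hexp : ∀ {f : ℝ → ℝ}, IntervalIntegrable f volume (-π) π →
      IntervalIntegrable (fun θ => Complex.exp (θ * Complex.I) ^ n * (f θ : ℂ)) volume (-π) π :=
    fun hf => (intervalIntegrable_ofReal hf).continuousOn_mul (by fun_prop)
  have hP := hexp (hψ.intervalIntegrable_deriv_sq_sub lam)
  have hW := (hexp (hψ.intervalIntegrable_mul_deriv lam)).const_mul (2 * Complex.I)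
  have hmode := hE.integral_exp_pow_mul_conjVelocitySq hψ n
  simp only [conjVelocitySq_eq, map_add, map_mul, map_ofNat, Complex.conj_ofReal, Complex.conj_I,
    mul_neg, neg_mul, ← sub_eq_add_neg, mul_add, mul_sub,
    mul_left_comm (Complex.exp _ ^ n) (2 * Complex.I)] at hmode
  rw [intervalIntegral.integral_add hP hW, intervalIntegral.integral_sub hP hW,
    intervalIntegral.integral_const_mul] at hmode
  rw [fourierCoeffOn_neg_pi_pi_neg_natCast, fourierCoeffOn_neg_pi_pi_neg_natCast]
  linear_combination -(1 / (π - -π) : ℝ) / 4 * hmode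

theorem IsWeakStationaryEuler.exists_isProfileSolution {p : 𝓓'(puncturedPlane, ℝ)}
    (hE : IsWeakStationaryEuler puncturedPlane (homVelocity lam ψ dψ) p)
    (hψ : IsH1Circle ψ dψ) : ∃ k, IsProfileSolution lam k ψ dψ := by
  refine hψ.exists_isProfileSolution fun m => ?_
  obtain ⟨n, rfl | rfl⟩ := m.eq_nat_or_neg
  · have hconj := congrArg conj (hE.fourierCoeffOn_neg_natCast hψ n)
    simp only [map_mul, map_neg, map_sub, map_add, map_pow, map_ofNat, map_one, map_natCast,
      Complex.conj_ofReal, Complex.conj_I, ← fourierCoeffOn_ofReal_neg, neg_neg] at hconj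
    rw [Int.cast_natCast]
    linear_combination -hconj
  · simpa using hE.fourierCoeffOn_neg_natCast hψ n

end Momentum

end HomEuler

end

theorem mainTheorem3 (lam : ℝ) (hlam : 0 < lam) (hlam' : lam < 1 / 2) (ψ dψ : ℝ → ℝ)
    (hψ : HomEuler.IsH1Circle ψ dψ)
    (hEuler : ∃ p : 𝓓'(HomEuler.puncturedPlane, ℝ),
      HomEuler.IsWeakStationaryEuler HomEuler.puncturedPlane
        (HomEuler.homVelocity lam ψ dψ) p) :
    HomEuler.IsTrivial lam ψ ∧
      ((∀ θ, ψ θ = 0) ∨ HomEuler.IsElliptic ψ) ∧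
      ¬ HomEuler.IsHyperbolic lam ψ ∧
      ¬ HomEuler.IsParabolic ψ ∧
      (HomEuler.IsElliptic ψ → HomEuler.IsRotational ψ) := by
  obtain ⟨p, hE⟩ := hEuler
  obtain ⟨k, hprofile⟩ := hE.exists_isProfileSolution hψ
  exact (hprofile.isRotational hψ hlam hlam').classification
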